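/- Let $d\ge 1$ and $\beta>0$. For every finite $X\subset\mathbb Z^d$ let $\Delta_X,m_X,\mu'_X\in\mathbb R$ be given, and assume thermodynamic stability: there is $\bar c<\infty$ such that for every nonempty finite $\Lambda\subset\mathbb Z^d$ $$\frac1{|\Lambda|}\sum_{X\subseteq\Lambda}|m_X|\le\bar c,\qquad \frac1{|\Lambda|}\sum_{X\subseteq\Lambda}|\mu'_X|\le\bar c,\qquad \frac1{|\Lambda|}\sum_{X\subseteq\Lambda}\Delta_X^2\le\bar c .$$ For finite $\Lambda'\subseteq\Lambda\subset\mathbb Z^d$ and $\mu\in\mathbb R$ let $J_X$, $X\subseteq\Lambda$, be independent Gaussian variables with variance $\Delta_X^2$ and with mean $\mu\mu'_X$ if $X\subseteq\Lambda'$ and $m_X$ otherwise, let $\widetilde J$ be an independent copy of $J$, and write $\mathrm{Av}$ for the average over $(J,\widetilde J)$. For $\sigma\in\{-1,1\}^\Lambda$ put $\sigma_X=\prod_{i\in X}\sigma_i$ (with $\sigma_\emptyset=0$) and, for $t\in[0,\pi]$, $$X_{\Lambda,t}(\sigma)=-\cos t\sum_{X\subseteq\Lambda'}J_X\sigma_X-\sin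 t\sum_{X\subseteq\Lambda'}\widetilde J_X\sigma_X-\sum_{X\subseteq\Lambda,\;X\not\subseteq\Lambda'}J_X\sigma_X .$$ Let $\omega_t$ be the random Gibbs state with weights proportional to $e^{-\beta X_{\Lambda,t}(\sigma)}$, and let $\langle\,\cdot\,\rangle_{t_1,\dots,t_n;\mu}=\mathrm{Av}\big[(\omega_{t_1}\otimes\cdots\otimes\omega_{t_n})(\,\cdot\,)\big]$ be the quenched state of $n$ replicas with the same disorder. Let $c^{\Lambda'}_{k,l}=\frac1{|\Lambda'|}\sum_{X\subseteq\Lambda'}\Delta_X^2\,\sigma^{(k)}_X\sigma^{(l)}_X$ be the normalized covariance in $\Lambda'$ of the replicas $k$ and $l$. Then for every $a>0$ and every interval $[\mu_1,\mu_2]$ $$\lim_{\substack{\Lambda,\Lambda'\nearrow\mathbb Z^d\\ |\Lambda'|/|\Lambda|\to a}}\int_{\mu_1}^{\mu_2}d\mu\int_0^\pi\!\!\int_0^\pi dt\,ds\,\sin^2(t-s)\Big[\big\langle (c^{\Lambda'}_{1,2})^2\big\rangle_{t,s;\mu}-2\big\langle c^{\Lambda'}_{1,2}c^{\Lambda'}_{2,3}\big\rangle_{s,t,s;\mu}+\big\langle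 c^{\Lambda'}_{1,2}c^{\Lambda'}_{3,4}\big\rangle_{t,s,s,t;\mu}\Big]=0 ,$$ where the limit is along arbitrary sequences of finite sets $\Lambda'_n\subseteq\Lambda_n$, each of which eventually contains every finite subset of $\mathbb Z^d$, with $|\Lambda'_n|/|\Lambda_n|\to a$. -/

import Mathlib

open Filter Topology MeasureTheory ProbabilityTheory

noncomputable section

namespace SpinFlip

/-- Sites of the lattice `ℤ^d`. -/
abbrev Site (d : ℕ) : Type := Fin d → ℤ

/-- Ising configurations on `Λ`: every site carries a spin `±1`. -/
abbrev Config {d : ℕ} (Λ : Finset (Site d)) : Type := ↥Λ → ℤˣ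

/-- One real coupling `J_X` for each `X ⊆ Λ`. -/
abbrev Couplings {d : ℕ} (Λ : Finset (Site d)) : Type := ↥Λ.powerset → ℝ

/-- `σ_X = ∏_{i ∈ X} σ_i` for `X ⊆ Λ`, with the convention `σ_∅ = 0`. -/
def spinProd {d : ℕ} {Λ : Finset (Site d)} (σ : Config Λ) (X : Finset (Site d)) : ℝ :=
  if X = ∅ then 0 else ∏ i : ↥Λ, if (i : Site d) ∈ X then (((σ i : ℤˣ) : ℤ) : ℝ) else 1

/-- `H_{Λ'}(σ) = -∑_{X ⊆ Λ'} J_X σ_X`. -/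
def hamIn {d : ℕ} {Λ : Finset (Site d)} (Λ' : Finset (Site d)) (J : Couplings Λ)
    (σ : Config Λ) : ℝ :=
  -∑ X : ↥Λ.powerset, if (X : Finset (Site d)) ⊆ Λ' then J X * spinProd σ X else 0

/-- `H_{Λ \ Λ'}(σ) = -∑_{X ⊆ Λ, X ⊄ Λ'} J_X σ_X`. -/
def hamOut {d : ℕ} {Λ : Finset (Site d)} (Λ' : Finset (Site d)) (J : Couplings Λ)
    (σ : Config Λ) : ℝ :=
  -∑ X : ↥Λ.powerset, if (X : Finset (Site d)) ⊆ Λ' then 0 else J X * spinProd σ X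

/-- The trigonometric interpolation of the full flip,
`X_{Λ,t}(σ) = cos t H_{Λ'}(σ) + sin t H̃_{Λ'}(σ) + H_{Λ \ Λ'}(σ)`;
the disorder is the pair `ω = (J, J̃)`. -/
def interpHam {d : ℕ} {Λ : Finset (Site d)} (Λ' : Finset (Site d)) (t : ℝ)
    (ω : Couplings Λ × Couplings Λ) (σ : Config Λ) : ℝ :=
  Real.cos t * hamIn Λ' ω.1 σ + Real.sin t * hamIn Λ' ω.2 σ + hamOut Λ' ω.1 σ

/-- The interpolated partition function `Z_β(t) = ∑_σ exp(-β X_{Λ,t}(σ))`. -/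
def partitionFn {d : ℕ} {Λ : Finset (Site d)} (β : ℝ) (Λ' : Finset (Site d)) (t : ℝ)
    (ω : Couplings Λ × Couplings Λ) : ℝ :=
  ∑ σ : Config Λ, Real.exp (-β * interpHam Λ' t ω σ)

/-- The random state `ω_{t_1,…,t_n} = ω_{t_1} ⊗ ⋯ ⊗ ω_{t_n}` on `n` replicas that share the
same disorder. -/
def randomState {d : ℕ} {Λ : Finset (Site d)} (β : ℝ) (Λ' : Finset (Site d)) {n : ℕ}
    (t : Fin n → ℝ) (ω : Couplings Λ × Couplings Λ) (f : (Fin n → Config Λ) → ℝ) : ℝ :=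
  (∏ k, (partitionFn β Λ' (t k) ω)⁻¹) *
    ∑ σ : Fin n → Config Λ, f σ * ∏ k, Real.exp (-β * interpHam Λ' (t k) ω (σ k))

/-- The means of the disorder: `μ μ'_X` for `X ⊆ Λ'`, and `m_X` for all the other `X`. -/
def paramMean {d : ℕ} (m m' : Finset (Site d) → ℝ) (Λ' : Finset (Site d)) (μ : ℝ)
    (X : Finset (Site d)) : ℝ :=
  if X ⊆ Λ' then μ * m' X else m X

/-- The law of independent Gaussian couplings `J_X`, `X ⊆ Λ`, with means `mean X` and
variances `Δ_X ^ 2`. -/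
def couplingLaw {d : ℕ} (Λ : Finset (Site d)) (mean Δ : Finset (Site d) → ℝ) :
    Measure (Couplings Λ) :=
  Measure.pi fun X : ↥Λ.powerset => gaussianReal (mean X) ⟨Δ X ^ 2, sq_nonneg _⟩

/-- The law of `(J, J̃)`, where `J̃` is an independent copy of `J`. -/
def disorderLaw {d : ℕ} (Λ : Finset (Site d)) (mean Δ : Finset (Site d) → ℝ) :
    Measure (Couplings Λ × Couplings Λ) :=
  (couplingLaw Λ mean Δ).prod (couplingLaw Λ mean Δ)

/-- The quenched state `⟨f⟩_{t_1,…,t_n;μ} = Av(ω_{t_1,…,t_n}(f))`. -/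
def quenched {d : ℕ} (β : ℝ) (Δ m m' : Finset (Site d) → ℝ) (Λ Λ' : Finset (Site d)) (μ : ℝ)
    {n : ℕ} (t : Fin n → ℝ) (f : (Fin n → Config Λ) → ℝ) : ℝ :=
  ∫ ω, randomState β Λ' t ω f ∂(disorderLaw Λ (paramMean m m' Λ' μ) Δ)

/-- The normalized covariance `c_{Λ'}(σ,τ) = |Λ'|⁻¹ ∑_{X ⊆ Λ'} Δ_X ^ 2 σ_X τ_X`. -/
def normCov {d : ℕ} {Λ : Finset (Site d)} (Δ : Finset (Site d) → ℝ) (Λ' : Finset (Site d))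
    (σ τ : Config Λ) : ℝ :=
  (∑ X ∈ Λ'.powerset, Δ X ^ 2 * spinProd σ X * spinProd τ X) / (Λ'.card : ℝ)

/-- The polynomial `⟨c_{1,2}²⟩_{t,s;μ} - 2 ⟨c_{1,2} c_{2,3}⟩_{s,t,s;μ} + ⟨c_{1,2} c_{3,4}⟩_{t,s,s,t;μ}`.
Replicas are numbered from `0`. -/
def repliconPoly {d : ℕ} (β : ℝ) (Δ m m' : Finset (Site d) → ℝ) (Λ Λ' : Finset (Site d))
    (μ t s : ℝ) : ℝ :=
  quenched β Δ m m' Λ Λ' μ ![t, s] (fun σ => normCov Δ Λ' (σ 0) (σ 1) ^ 2)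
    - 2 * quenched β Δ m m' Λ Λ' μ ![s, t, s]
        (fun σ => normCov Δ Λ' (σ 0) (σ 1) * normCov Δ Λ' (σ 1) (σ 2))
    + quenched β Δ m m' Λ Λ' μ ![t, s, s, t]
        (fun σ => normCov Δ Λ' (σ 0) (σ 1) * normCov Δ Λ' (σ 2) (σ 3))

/-- Thermodynamic stability for means `mean X` and variances `Δ_X ^ 2`. -/
def ThermStable {d : ℕ} (mean Δ : Finset (Site d) → ℝ) : Prop :=
  ∃ c : ℝ, ∀ Λ : Finset (Site d), Λ.Nonempty →
    (∑ X ∈ Λ.powerset, |mean X|) / (Λ.card : ℝ) ≤ c ∧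
    (∑ X ∈ Λ.powerset, Δ X ^ 2) / (Λ.card : ℝ) ≤ c

end SpinFlip

end

/-! The interpolation rotates the couplings inside `Λ'` from `J` at `t = 0` to `-J` at `t = π`. The
change of the pressure `log Z` along the path is `β` times the sum of two integrals over `t`:
`meanFlow`, produced by the means of the couplings, and `flow`, produced by their centred Gaussian
parts. At each `t` the Gaussian velocity of the rotation is orthogonal to the position, so `flow`
has mean zero. Double integration by parts gives its variance as the double integral of `cos (t - s)
* overlap - β² sin² (t - s) * replicon`, where `replicon` is the disorder average of `∑ Δ_X² Δ_Y²`
times the truncated correlations of `σ_X, σ_Y` at `t` and at `s` (`integral_flow_sq`).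

Everything except the replicon is `o(|Λ'|²)`. The overlap term is at most `π²` times the total
variance, hence `O(|Λ|)`. The variance of `flow` is controlled by the variances of the pressure at
the two ends, which are `O(|Λ|)` by an Efron–Stein bound (`variance_press_le`), and by the variance
of `meanFlow`. The latter is an integral of fluctuations of the magnetization conjugate to `μ`. The
pressure is convex in `μ` and has variance `O(|Λ|)`, so after integration over `μ` this
magnetization is self-averaging (`integral_varMagIn_le`), except possibly at the single `t` where
`cos t + sin t = 0`.

Hence the integral of `sin² * replicon` divided by `|Λ'|²` tends to zero. Expanding the truncated
correlations yields the polynomial of the theorem, except that the mixed terms appear once with `(t,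
s)` and once with `(s, t)`. The difference is antisymmetric and integrates to zero against `sin² (t
- s)` (`pairSum_sub_add_eq`, `integral_sin_sq_mul_symm`). -/

noncomputable section

namespace SpinFlip

/-! ### Standard Gaussian vectors: resampling, integration by parts, Efron–Stein inequality. -/

/-- The law of a family of independent standard Gaussian variables. -/
def stdNormal (κ : Type*) [Fintype κ] : Measure (κ → ℝ) :=
  Measure.pi fun _ => gaussianReal 0 1

section Gaussian

variable {κ : Type*} [Fintype κ]

instance : IsProbabilityMeasure (stdNormal κ) := by
  unfold stdNormal; infer_instance

/-- Resampling one coordinate independently does not change a product law. This reduces both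
integration by parts and the Efron–Stein bound to one-dimensional statements. -/
lemma measurePreserving_update [DecidableEq κ] (k : κ) :
    MeasurePreserving (fun p : (κ → ℝ) × ℝ => Function.update p.1 k p.2)
      ((stdNormal κ).prod (gaussianReal 0 1)) (stdNormal κ) := by
  have hm : Measurable (fun p : (κ → ℝ) × ℝ => Function.update p.1 k p.2) := by
    rw [measurable_pi_iff]
    intro i
    by_cases h : i = k
    · subst h; simpa using measurable_snd
    · simp only [Function.update_of_ne h]; fun_prop
  refine ⟨hm, ?_⟩
  symm
  refine Measure.pi_eq fun s hs => ?_
  rw [Measure.map_apply hm (MeasurableSet.univ_pi hs)]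
  have : (fun p : (κ → ℝ) × ℝ => Function.update p.1 k p.2) ⁻¹' (Set.univ.pi s)
      = (Set.univ.pi (Function.update s k Set.univ)) ×ˢ (s k) := by
    ext p
    simp only [Set.mem_preimage, Set.mem_pi, Set.mem_univ, true_implies, Set.mem_prod]
    constructor
    · intro h
      refine ⟨fun i => ?_, by simpa using h k⟩
      by_cases hi : i = k
      · subst hi; simp
      · simpa [Function.update_of_ne hi] using h i
    · rintro ⟨h, hk⟩ i
      by_cases hi : i = k
      · subst hi; simpa using hk
      · simpa [Function.update_of_ne hi] using h i
  rw [this, Measure.prod_prod, stdNormal, Measure.pi_pi,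
    ← Finset.mul_prod_erase Finset.univ (fun i => gaussianReal 0 1 (s i)) (Finset.mem_univ k),
    ← Finset.mul_prod_erase Finset.univ _ (Finset.mem_univ k), mul_comm]
  simp only [Function.update_self, measure_univ, one_mul]
  congr 1
  refine Finset.prod_congr rfl fun i hi => ?_
  rw [Function.update_of_ne (Finset.ne_of_mem_erase hi)]

lemma integrable_comp_update [DecidableEq κ] (k : κ) {G : (κ → ℝ) → ℝ}
    (hG : Integrable G (stdNormal κ)) :
    Integrable (fun p : (κ → ℝ) × ℝ => G (Function.update p.1 k p.2))
      ((stdNormal κ).prod (gaussianReal 0 1)) :=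
  (measurePreserving_update k).integrable_comp_of_integrable hG

lemma integral_eq_integral_update [DecidableEq κ] (k : κ) {G : (κ → ℝ) → ℝ}
    (hG : Integrable G (stdNormal κ)) :
    ∫ g, G g ∂stdNormal κ
      = ∫ g, ∫ x, G (Function.update g k x) ∂gaussianReal 0 1 ∂stdNormal κ := by
  have mp := measurePreserving_update k
  have hGm := hG.aestronglyMeasurable
  rw [← integral_prod _ (integrable_comp_update k hG)]
  conv_lhs => rw [← mp.map_eq]
  rw [← mp.map_eq] at hGm
  rw [integral_map mp.measurable.aemeasurable hGm]

lemma integrable_sq_eval (k : κ) : Integrable (fun g : κ → ℝ => g k ^ 2) (stdNormal κ) := by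
  have h : Integrable (fun x : ℝ => x ^ 2) (gaussianReal 0 1) :=
    (memLp_id_gaussianReal 2).integrable_sq
  exact integrable_comp_eval (μ := fun _ : κ => gaussianReal 0 1) (i := k) h

/-- Quadratic growth is the common dominating function below: the speed grows linearly in the
Gaussian vector, and at most two such factors are ever multiplied. -/
lemma integrable_one_add_norm_sq :
    Integrable (fun g : κ → ℝ => (1 + ‖g‖) ^ 2) (stdNormal κ) := by
  have h : Integrable (fun g : κ → ℝ => 2 * (1 + ∑ k, g k ^ 2)) (stdNormal κ) :=
    ((integrable_const 1).add
      (integrable_finsetSum _ fun k _ => integrable_sq_eval k)).const_mul 2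
  refine h.mono' (by fun_prop) (ae_of_all _ fun g => ?_)
  have hn : ‖g‖ ^ 2 ≤ ∑ k, g k ^ 2 := by
    have hS : 0 ≤ ∑ k, g k ^ 2 := Finset.sum_nonneg fun _ _ => sq_nonneg _
    have : ‖g‖ ≤ √(∑ k, g k ^ 2) := by
      refine (pi_norm_le_iff_of_nonneg (Real.sqrt_nonneg _)).2 fun k => ?_
      refine Real.le_sqrt_of_sq_le ?_
      rw [Real.norm_eq_abs, sq_abs]
      exact Finset.single_le_sum (f := fun k => g k ^ 2) (fun _ _ => sq_nonneg _)
        (Finset.mem_univ k)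
    calc ‖g‖ ^ 2 ≤ √(∑ k, g k ^ 2) ^ 2 := by gcongr
      _ = _ := Real.sq_sqrt hS
  rw [Real.norm_of_nonneg (by positivity)]
  nlinarith [sq_nonneg (1 - ‖g‖)]

lemma integrable_of_growth {F : (κ → ℝ) → ℝ} (hF : AEStronglyMeasurable F (stdNormal κ)) {C : ℝ}
    (hC : ∀ g, |F g| ≤ C * (1 + ‖g‖) ^ 2) : Integrable F (stdNormal κ) :=
  (integrable_one_add_norm_sq.const_mul C).mono' hF (ae_of_all _ hC)

lemma integrable_of_linear_growth {F : (κ → ℝ) → ℝ} (hF : AEStronglyMeasurable F (stdNormal κ))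
    {C : ℝ} (hC : ∀ g, |F g| ≤ C * (1 + ‖g‖)) : Integrable F (stdNormal κ) := by
  refine integrable_of_growth hF (C := C) fun g => (hC g).trans ?_
  have hC0 : 0 ≤ C := by simpa using (abs_nonneg _).trans (hC 0)
  have := norm_nonneg g
  gcongr
  nlinarith

lemma memLp_two_of_linear_growth {F : (κ → ℝ) → ℝ}
    (hF : AEStronglyMeasurable F (stdNormal κ)) {C : ℝ} (hC : ∀ g, |F g| ≤ C * (1 + ‖g‖)) :
    MemLp F 2 (stdNormal κ) := by
  rw [memLp_two_iff_integrable_sq hF]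
  refine integrable_of_growth (hF.pow 2) (C := C ^ 2) fun g => ?_
  rw [abs_pow, ← mul_pow]
  exact pow_le_pow_left₀ (abs_nonneg _) (hC g) 2

/-- Stein's identity: the Gaussian density `φ` satisfies `φ' = -x φ`, so this is integration by
parts on the line, with integrability replacing boundary terms. -/
lemma integral_gaussianReal_mul_eq_deriv {f f' : ℝ → ℝ} (hf : ∀ x, HasDerivAt f (f' x) x)
    (h0 : Integrable f (gaussianReal 0 1)) (h1 : Integrable f' (gaussianReal 0 1))
    (h2 : Integrable (fun x => x * f x) (gaussianReal 0 1)) :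
    ∫ x, x * f x ∂gaussianReal 0 1 = ∫ x, f' x ∂gaussianReal 0 1 := by
  have key : ∀ h : ℝ → ℝ, Integrable h (gaussianReal 0 1) →
      Integrable (fun x => h x * gaussianPDFReal 0 1 x) := by
    intro h hh
    rw [gaussianReal_of_var_ne_zero 0 one_ne_zero] at hh
    have := (integrable_withDensity_iff_integrable_smul' (measurable_gaussianPDF 0 1)
      (ae_of_all _ fun x => gaussianPDF_lt_top)).1 hh
    simpa [toReal_gaussianPDF, mul_comm] using this
  have hpdf : ∀ x, HasDerivAt (gaussianPDFReal 0 1) (-x * gaussianPDFReal 0 1 x) x := by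
    intro x
    rw [gaussianPDFReal_def]
    have h : HasDerivAt (fun x : ℝ => -(x - 0) ^ 2 / (2 * ((1 : NNReal) : ℝ))) (-x) x := by
      have := ((((hasDerivAt_id' x).sub_const 0).fun_pow 2).fun_neg.div_const
        (2 * ((1 : NNReal) : ℝ)))
      refine this.congr_deriv ?_
      simp only [NNReal.coe_one]; ring
    refine (h.exp.const_mul (√(2 * Real.pi * ((1 : NNReal) : ℝ)))⁻¹).congr_deriv ?_
    ring
  have := integral_mul_deriv_eq_deriv_mul_of_integrable (u := f) (v := gaussianPDFReal 0 1)
    (u' := f') (v' := fun x => -x * gaussianPDFReal 0 1 x) (fun x _ => hf x) (fun x _ => hpdf x)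
    (by
      have := (key _ h2).neg
      refine this.congr (ae_of_all _ fun x => ?_)
      simp; ring) (key _ h1) (key _ h0)
  rw [integral_gaussianReal_eq_integral_smul one_ne_zero,
    integral_gaussianReal_eq_integral_smul one_ne_zero]
  simp only [smul_eq_mul]
  calc ∫ x, gaussianPDFReal 0 1 x * (x * f x)
      = -∫ x, f x * (-x * gaussianPDFReal 0 1 x) := by
        rw [← integral_neg]; congr 1; ext x; ring
    _ = ∫ x, f' x * gaussianPDFReal 0 1 x := by rw [this, neg_neg]
    _ = _ := by congr 1; ext x; ring

lemma integral_eval_mul_eq_fderiv [DecidableEq κ] {F : (κ → ℝ) → ℝ} (hF : ContDiff ℝ 1 F) {C : ℝ}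
    (hC : ∀ g, |F g| ≤ C * (1 + ‖g‖)) (k : κ) {C' : ℝ}
    (hC' : ∀ g, |fderiv ℝ F g (Pi.single k 1)| ≤ C' * (1 + ‖g‖)) :
    ∫ g, g k * F g ∂stdNormal κ = ∫ g, fderiv ℝ F g (Pi.single k 1) ∂stdNormal κ := by
  have hcont := hF.continuous
  have hcont' : Continuous fun g => fderiv ℝ F g (Pi.single k 1) :=
    (hF.continuous_fderiv one_ne_zero).clm_apply continuous_const
  have i0 : Integrable F (stdNormal κ) := integrable_of_linear_growth hcont.aestronglyMeasurable hC
  have i1 : Integrable (fun g => fderiv ℝ F g (Pi.single k 1)) (stdNormal κ) :=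
    integrable_of_linear_growth hcont'.aestronglyMeasurable hC'
  have i2 : Integrable (fun g => g k * F g) (stdNormal κ) := by
    refine integrable_of_growth (by fun_prop) (C := C) fun g => ?_
    rw [abs_mul]
    have h1 : |g k| ≤ 1 + ‖g‖ := (norm_le_pi_norm g k).trans (by linarith)
    calc |g k| * |F g| ≤ (1 + ‖g‖) * (C * (1 + ‖g‖)) :=
          mul_le_mul h1 (hC g) (abs_nonneg _) (by positivity)
      _ = _ := by ring
  rw [integral_eq_integral_update k i2, integral_eq_integral_update k i1]
  refine integral_congr_ae ?_
  -- Fubini gives integrability along almost every line parallel to the `k`-th axis, which is where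
  -- the one-dimensional identity is applied.
  filter_upwards [(integrable_comp_update k i0).prod_right_ae,
    (integrable_comp_update k i1).prod_right_ae, (integrable_comp_update k i2).prod_right_ae] with g h0 h1 h2
  simp only [Function.update_self] at h2 ⊢
  refine integral_gaussianReal_mul_eq_deriv (fun x => ?_) h0 h1 h2
  have := ((hF.differentiable one_ne_zero) (Function.update g k x)).hasFDerivAt.comp_hasDerivAt x
    (hasDerivAt_update g k x)
  exact this

/-- Gaussian integration by parts along the direction `v`. -/
lemma integral_inner_mul_eq {F : (κ → ℝ) → ℝ} (hF : ContDiff ℝ 1 F) {C : ℝ}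
    (hC : ∀ g, |F g| ≤ C * (1 + ‖g‖)) {D : (κ → ℝ) → (κ → ℝ) → ℝ}
    (hD : ∀ g v, HasDerivAt (fun τ : ℝ => F (g + τ • v)) (D g v) 0)
    (hC' : ∀ v, ∃ C' : ℝ, ∀ g, |D g v| ≤ C' * (1 + ‖g‖)) (v : κ → ℝ) :
    ∫ g, (∑ k, v k * g k) * F g ∂stdNormal κ = ∫ g, D g v ∂stdNormal κ := by
  classical
  have hDF : ∀ g v, D g v = fderiv ℝ F g v := by
    intro g v
    have h : HasLineDerivAt ℝ F (D g v) g v := hD g v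
    exact h.lineDeriv.symm.trans
      ((hF.differentiable one_ne_zero) g).lineDeriv_eq_fderiv
  have hcont' : ∀ w, Continuous fun g => fderiv ℝ F g w := fun w =>
    (hF.continuous_fderiv one_ne_zero).clm_apply continuous_const
  have hlin : ∀ g, fderiv ℝ F g v = ∑ k, v k * fderiv ℝ F g (Pi.single k 1) := by
    intro g
    conv_lhs => rw [pi_eq_sum_univ' v]
    simp [map_sum, map_smul]
  have i2 : ∀ k, Integrable (fun g : κ → ℝ => g k * F g) (stdNormal κ) := by
    intro k
    have hc := hF.continuous
    refine integrable_of_growth (by fun_prop) (C := C) fun g => ?_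
    rw [abs_mul]
    have h1 : |g k| ≤ 1 + ‖g‖ := (norm_le_pi_norm g k).trans (by linarith)
    calc |g k| * |F g| ≤ (1 + ‖g‖) * (C * (1 + ‖g‖)) :=
          mul_le_mul h1 (hC g) (abs_nonneg _) (by positivity)
      _ = _ := by ring
  have i1 : ∀ k, Integrable (fun g => fderiv ℝ F g (Pi.single k 1)) (stdNormal κ) := by
    intro k
    obtain ⟨C', h⟩ := hC' (Pi.single k 1)
    exact integrable_of_linear_growth (hcont' _).aestronglyMeasurable (by simpa [hDF] using h)
  simp_rw [hDF, hlin, Finset.sum_mul, mul_assoc]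
  rw [integral_finsetSum _ fun k _ => (i2 k).const_mul _,
    integral_finsetSum _ fun k _ => (i1 k).const_mul _]
  refine Finset.sum_congr rfl fun k _ => ?_
  rw [integral_const_mul, integral_const_mul]
  obtain ⟨C', h⟩ := hC' (Pi.single k 1)
  rw [integral_eval_mul_eq_fderiv hF hC k (by simpa [hDF] using h)]

lemma integral_sq_gaussianReal : ∫ x, x ^ 2 ∂gaussianReal 0 1 = 1 := by
  have := variance_fun_id_gaussianReal (μ := 0) (v := 1)
  rw [variance_of_integral_eq_zero (by fun_prop) (by simp)] at this
  simpa using this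

lemma continuous_of_coord_lipschitz {f : (κ → ℝ) → ℝ} {l : κ → ℝ}
    (hf : ∀ x y, |f x - f y| ≤ ∑ k, l k * |x k - y k|) : Continuous f := by
  rw [continuous_iff_continuousAt]
  intro x
  rw [ContinuousAt, tendsto_iff_dist_tendsto_zero]
  have h : Tendsto (fun y : κ → ℝ => ∑ k, l k * |y k - x k|) (𝓝 x) (𝓝 0) := by
    have : Continuous fun y : κ → ℝ => ∑ k, l k * |y k - x k| := by fun_prop
    simpa using this.tendsto x
  exact squeeze_zero (fun _ => dist_nonneg) (fun y => hf y x) h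

lemma linear_growth_of_coord_lipschitz {f : (κ → ℝ) → ℝ} {l : κ → ℝ} (hl : ∀ k, 0 ≤ l k)
    (hf : ∀ x y, |f x - f y| ≤ ∑ k, l k * |x k - y k|) (g : κ → ℝ) :
    |f g| ≤ (|f 0| + ∑ k, l k) * (1 + ‖g‖) := by
  have h1 : |f g| ≤ |f 0| + |f g - f 0| := by
    have := abs_add_le (f 0) (f g - f 0); simpa using this
  have h2 : |f g - f 0| ≤ (∑ k, l k) * ‖g‖ := by
    refine (hf g 0).trans ?_
    rw [Finset.sum_mul]
    refine Finset.sum_le_sum fun k _ => mul_le_mul_of_nonneg_left ?_ (hl k)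
    simpa using norm_le_pi_norm g k
  have h3 : 0 ≤ ∑ k, l k := Finset.sum_nonneg fun k _ => hl k
  nlinarith [abs_nonneg (f 0), norm_nonneg g, mul_nonneg (abs_nonneg (f 0)) (norm_nonneg g)]

/-- Subtracting `f 0` leaves the variance unchanged, and the second moment of `f - f 0` is at most
`a²` times that of a standard Gaussian variable. -/
lemma integral_sub_sq_gaussianReal_le {f : ℝ → ℝ} {a : ℝ} (hfc : Continuous f)
    (hf : ∀ x y, |f x - f y| ≤ a * |x - y|) :
    ∫ x, (f x - ∫ y, f y ∂gaussianReal 0 1) ^ 2 ∂gaussianReal 0 1 ≤ a ^ 2 := by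
  have hb : ∀ x, (f x - f 0) ^ 2 ≤ a ^ 2 * x ^ 2 := by
    intro x
    rw [← mul_pow]
    refine sq_le_sq.2 ?_
    have := hf x 0
    rw [sub_zero] at this
    refine this.trans ?_
    rw [abs_mul]
    exact mul_le_mul_of_nonneg_right (le_abs_self a) (abs_nonneg x)
  have hi : Integrable (fun x : ℝ => a ^ 2 * x ^ 2) (gaussianReal 0 1) :=
    ((memLp_id_gaussianReal 2).integrable_sq).const_mul _
  calc ∫ x, (f x - ∫ y, f y ∂gaussianReal 0 1) ^ 2 ∂gaussianReal 0 1
      = Var[f; gaussianReal 0 1] := (variance_eq_integral hfc.aemeasurable).symm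
    _ = Var[fun x => f x - f 0; gaussianReal 0 1] :=
        (variance_sub_const hfc.aestronglyMeasurable _).symm
    _ ≤ ∫ x, (f x - f 0) ^ 2 ∂gaussianReal 0 1 :=
        variance_le_expectation_sq (by fun_prop)
    _ ≤ ∫ x, a ^ 2 * x ^ 2 ∂gaussianReal 0 1 :=
        integral_mono_of_nonneg (ae_of_all _ fun x => sq_nonneg _) hi (ae_of_all _ hb)
    _ = a ^ 2 := by rw [integral_const_mul, integral_sq_gaussianReal, mul_one]

lemma integrable_gaussianReal_of_lipschitz {f : ℝ → ℝ} {a : ℝ} (hfc : Continuous f)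
    (hf : ∀ x y, |f x - f y| ≤ a * |x - y|) : Integrable f (gaussianReal 0 1) := by
  have hi : Integrable (fun x : ℝ => |f 0| + a * |x|) (gaussianReal 0 1) :=
    (integrable_const _).add (((memLp_id_gaussianReal 1).integrable le_rfl).abs.const_mul a)
  refine hi.mono' hfc.aestronglyMeasurable (ae_of_all _ fun x => ?_)
  have := hf x 0
  rw [sub_zero] at this
  have h2 := abs_add_le (f 0) (f x - f 0)
  rw [add_sub_cancel] at h2
  rw [Real.norm_eq_abs]; linarith

/-- Efron–Stein bound for coordinatewise Lipschitz functions of Gaussian variables; only the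
coordinates in `s` matter. -/
lemma variance_le_sum_sq_of_support [DecidableEq κ] (s : Finset κ) :
    ∀ {f : (κ → ℝ) → ℝ} {l : κ → ℝ}, (∀ k, 0 ≤ l k) → (∀ k ∉ s, l k = 0) →
      (∀ x y, |f x - f y| ≤ ∑ k, l k * |x k - y k|) →
      Var[f; stdNormal κ] ≤ ∑ k ∈ s, l k ^ 2 := by
  induction s using Finset.induction_on with
  | empty =>
    intro f l _ h0 hf
    have : f = fun _ => f 0 := by
      ext x
      have := hf x 0
      simp only [h0 _ (Finset.notMem_empty _), zero_mul, Finset.sum_const_zero] at this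
      linarith [abs_nonpos_iff.1 this]
    rw [this, variance_eq_integral (by fun_prop)]
    simp
  | insert k s hk ih =>
    intro f l hl h0 hf
    have hfc := continuous_of_coord_lipschitz hf
    have hupd : ∀ g : κ → ℝ, ∀ x y : ℝ,
        |f (Function.update g k x) - f (Function.update g k y)| ≤ l k * |x - y| := by
      intro g x y
      refine (hf _ _).trans (le_of_eq ?_)
      rw [Finset.sum_eq_single k]
      · simp
      · intro i _ hi; simp [Function.update_of_ne hi]
      · simp
    have hupdc : ∀ g : κ → ℝ, Continuous fun x : ℝ => f (Function.update g k x) := fun g =>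
      hfc.comp (continuous_const.update k continuous_id)
    have hfi : ∀ g : κ → ℝ, Integrable (fun x => f (Function.update g k x)) (gaussianReal 0 1) :=
      fun g => integrable_gaussianReal_of_lipschitz (hupdc g) (hupd g)
    -- `F` averages out the coordinate `k`. It keeps the Lipschitz constants of the other
    -- coordinates, so the induction hypothesis bounds its variance, while `f - F` carries the
    -- fluctuation in the coordinate `k` alone.
    set F : (κ → ℝ) → ℝ := fun g => ∫ x, f (Function.update g k x) ∂gaussianReal 0 1 with hF
    have hFl : ∀ x y, |F x - F y| ≤ ∑ i, (if i = k then 0 else l i) * |x i - y i| := by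
      intro x y
      simp only [hF]
      rw [← integral_sub (hfi x) (hfi y), ← Real.norm_eq_abs]
      refine (norm_integral_le_of_norm_le_const (μ := gaussianReal 0 1)
        (C := ∑ i, (if i = k then 0 else l i) * |x i - y i|)
        (ae_of_all _ fun z => ?_)).trans (by rw [probReal_univ, mul_one])
      refine (hf _ _).trans (le_of_eq (Finset.sum_congr rfl fun i _ => ?_))
      by_cases hi : i = k
      · subst hi; simp
      · simp [hi]
    have hFc := continuous_of_coord_lipschitz hFl
    have hl' : ∀ i, 0 ≤ (if i = k then 0 else l i) := fun i => by split_ifs; exacts [le_rfl, hl i]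
    have hFu : ∀ g x, F (Function.update g k x) = F g := by intro g x; simp [hF]
    have ihF := ih (f := F) hl' (by
      intro i hi
      by_cases h : i = k
      · simp [h]
      · simp [h, h0 i (by simp [h, hi])]) hFl
    have hfL : MemLp f 2 (stdNormal κ) := memLp_two_of_linear_growth hfc.aestronglyMeasurable
      (linear_growth_of_coord_lipschitz hl hf)
    have hFL : MemLp F 2 (stdNormal κ) := memLp_two_of_linear_growth hFc.aestronglyMeasurable
      (linear_growth_of_coord_lipschitz hl' hFl)
    have hdL := hfL.sub hFL
    have hsplit : f = F + (f - F) := by ext; simp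
    have hEd : ∫ g, (f - F) g ∂stdNormal κ = 0 := by
      rw [integral_eq_integral_update k (hdL.integrable one_le_two)]
      simp only [Pi.sub_apply, hFu]
      simp_rw [integral_sub (hfi _) (integrable_const _)]
      simp [hF]
    -- `F` does not depend on the coordinate `k`, and `f - F` has mean zero when only that
    -- coordinate is integrated.
    have hcov : cov[F, f - F; stdNormal κ] = 0 := by
      rw [covariance_eq_sub hFL hdL, hEd, mul_zero, sub_zero]
      have : Integrable (F * (f - F)) (stdNormal κ) := hFL.integrable_mul hdL
      rw [integral_eq_integral_update k this]
      simp only [Pi.mul_apply, Pi.sub_apply, hFu, integral_const_mul]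
      simp_rw [integral_sub (hfi _) (integrable_const _)]
      simp [hF]
    have hvar : Var[f - F; stdNormal κ] ≤ l k ^ 2 := by
      rw [variance_of_integral_eq_zero (by fun_prop) hEd]
      rw [integral_eq_integral_update k (by simpa using hdL.integrable_sq)]
      simp only [Pi.sub_apply, hFu]
      refine (integral_mono_of_nonneg (g := fun _ => l k ^ 2)
        (ae_of_all _ fun g => integral_nonneg fun _ => sq_nonneg _) (integrable_const _)
        (ae_of_all _ fun g => ?_)).trans (by simp)
      exact integral_sub_sq_gaussianReal_le (hupdc g) (hupd g)
    rw [hsplit, variance_add hFL hdL, hcov, Finset.sum_insert hk]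
    have : ∑ i ∈ s, (if i = k then 0 else l i) ^ 2 = ∑ i ∈ s, l i ^ 2 :=
      Finset.sum_congr rfl fun i hi => by rw [if_neg (ne_of_mem_of_not_mem hi hk)]
    linarith

lemma variance_le_sum_sq {f : (κ → ℝ) → ℝ} {l : κ → ℝ} (hl : ∀ k, 0 ≤ l k)
    (hf : ∀ x y, |f x - f y| ≤ ∑ k, l k * |x k - y k|) :
    Var[f; stdNormal κ] ≤ ∑ k, l k ^ 2 := by
  classical
  exact variance_le_sum_sq_of_support Finset.univ hl (by simp) hf

end Gaussian

/-! ### Gibbs averages, their derivatives, and convexity of the pressure. -/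

/-- The Gibbs average of `f` for the weights `exp (w σ)`. -/
def gibbs {S : Type*} [Fintype S] (w f : S → ℝ) : ℝ :=
  (∑ σ, f σ * Real.exp (w σ)) / ∑ σ, Real.exp (w σ)

/-- The truncated correlation of `f` and `h` for the weights `exp (w σ)`. -/
def gibbsCov {S : Type*} [Fintype S] (w f h : S → ℝ) : ℝ :=
  gibbs w (fun σ => f σ * h σ) - gibbs w f * gibbs w h

/-- The logarithm of the partition function for the weights `exp (w σ)`. -/
def logPart {S : Type*} [Fintype S] (w : S → ℝ) : ℝ := Real.log (∑ σ, Real.exp (w σ))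

section Gibbs

variable {S : Type*} [Fintype S]

lemma sum_exp_pos [Nonempty S] (w : S → ℝ) : 0 < ∑ σ, Real.exp (w σ) :=
  Finset.sum_pos (fun _ _ => Real.exp_pos _) Finset.univ_nonempty

lemma gibbs_add (w f h : S → ℝ) : gibbs w (fun σ => f σ + h σ) = gibbs w f + gibbs w h := by
  simp only [gibbs, add_mul, Finset.sum_add_distrib, add_div]

lemma gibbs_const_mul (w f : S → ℝ) (c : ℝ) : gibbs w (fun σ => c * f σ) = c * gibbs w f := by
  simp only [gibbs, mul_assoc, ← Finset.mul_sum, mul_div_assoc]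

lemma gibbs_sum {ι : Type*} (s : Finset ι) (w : S → ℝ) (f : ι → S → ℝ) :
    gibbs w (fun σ => ∑ i ∈ s, f i σ) = ∑ i ∈ s, gibbs w (f i) := by
  simp only [gibbs, Finset.sum_mul, Finset.sum_div]
  rw [Finset.sum_comm]

lemma gibbs_zero (w : S → ℝ) : gibbs w (fun _ => 0) = 0 := by simp [gibbs]

lemma gibbs_const [Nonempty S] (w : S → ℝ) (c : ℝ) : gibbs w (fun _ => c) = c := by
  rw [gibbs, ← Finset.mul_sum, mul_div_cancel_right₀ _ (sum_exp_pos w).ne']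

lemma gibbs_mono [Nonempty S] (w : S → ℝ) {f h : S → ℝ} (hfh : ∀ σ, f σ ≤ h σ) :
    gibbs w f ≤ gibbs w h := by
  unfold gibbs
  gcongr with σ
  exact hfh σ

lemma abs_gibbs_le [Nonempty S] (w : S → ℝ) {f : S → ℝ} {C : ℝ} (hC : ∀ σ, |f σ| ≤ C) :
    |gibbs w f| ≤ C := by
  rw [abs_le]
  constructor
  · rw [← gibbs_const w (-C)]
    exact gibbs_mono w fun σ => (abs_le.1 (hC σ)).1
  · conv_rhs => rw [← gibbs_const w C]
    exact gibbs_mono w fun σ => (abs_le.1 (hC σ)).2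

lemma abs_gibbs_le_sum [Nonempty S] (w f : S → ℝ) : |gibbs w f| ≤ ∑ σ, |f σ| :=
  abs_gibbs_le w fun σ =>
    Finset.single_le_sum (f := fun σ => |f σ|) (fun _ _ => abs_nonneg _) (Finset.mem_univ σ)

lemma exists_abs_gibbsCov_le [Nonempty S] (f h : S → ℝ) :
    ∃ C, 0 ≤ C ∧ ∀ w, |gibbsCov w f h| ≤ C := by
  refine ⟨(∑ σ, |f σ * h σ|) + (∑ σ, |f σ|) * ∑ σ, |h σ|, by positivity, fun w => ?_⟩
  refine (abs_sub _ _).trans (add_le_add (abs_gibbs_le_sum _ _) ?_)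
  rw [abs_mul]
  exact mul_le_mul (abs_gibbs_le_sum _ _) (abs_gibbs_le_sum _ _) (abs_nonneg _) (by positivity)

lemma gibbsCov_zero (w f : S → ℝ) : gibbsCov w f (fun _ => 0) = 0 := by
  simp [gibbsCov, gibbs_zero]

lemma gibbsCov_const_mul (w f h : S → ℝ) (c : ℝ) :
    gibbsCov w f (fun σ => c * h σ) = c * gibbsCov w f h := by
  have : (fun σ => f σ * (c * h σ)) = fun σ => c * (f σ * h σ) := by ext; ring
  rw [gibbsCov, gibbsCov, this, gibbs_const_mul, gibbs_const_mul]; ring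

lemma gibbsCov_comm (w f h : S → ℝ) : gibbsCov w f h = gibbsCov w h f := by
  simp only [gibbsCov, mul_comm]

lemma hasDerivAt_sum_mul_exp {w : ℝ → S → ℝ} {w' : S → ℝ} {τ : ℝ}
    (hw : ∀ σ, HasDerivAt (fun x => w x σ) (w' σ) τ) (f : S → ℝ) :
    HasDerivAt (fun x => ∑ σ, f σ * Real.exp (w x σ))
      (∑ σ, f σ * w' σ * Real.exp (w τ σ)) τ := by
  refine HasDerivAt.fun_sum fun σ _ => ?_
  refine (((hw σ).exp).const_mul (f σ)).congr_deriv ?_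
  ring

/-- Fluctuation–dissipation: differentiating the quotient of numerator and partition function
produces the truncated correlation with the derivative of the exponent. -/
lemma hasDerivAt_gibbs [Nonempty S] {w : ℝ → S → ℝ} {w' : S → ℝ} {τ : ℝ}
    (hw : ∀ σ, HasDerivAt (fun x => w x σ) (w' σ) τ) (f : S → ℝ) :
    HasDerivAt (fun x => gibbs (w x) f) (gibbsCov (w τ) f w') τ := by
  have hZ := hasDerivAt_sum_mul_exp hw fun _ => 1
  simp only [one_mul] at hZ
  have hne := (sum_exp_pos (w τ)).ne'
  refine ((hasDerivAt_sum_mul_exp hw f).fun_div hZ hne).congr_deriv ?_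
  simp only [gibbsCov, gibbs]
  field_simp

lemma hasDerivAt_logPart [Nonempty S] {w : ℝ → S → ℝ} {w' : S → ℝ} {τ : ℝ}
    (hw : ∀ σ, HasDerivAt (fun x => w x σ) (w' σ) τ) :
    HasDerivAt (fun x => logPart (w x)) (gibbs (w τ) w') τ := by
  have hZ := hasDerivAt_sum_mul_exp hw fun _ => 1
  simp only [one_mul] at hZ
  exact hZ.log (sum_exp_pos (w τ)).ne'

lemma hasDerivAt_gibbsCov [Nonempty S] {w : ℝ → S → ℝ} {w' : S → ℝ} {τ : ℝ}
    (hw : ∀ σ, HasDerivAt (fun x => w x σ) (w' σ) τ) (f h : S → ℝ) :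
    HasDerivAt (fun x => gibbsCov (w x) f h)
      (gibbsCov (w τ) (fun σ => f σ * h σ) w'
        - (gibbsCov (w τ) f w' * gibbs (w τ) h + gibbs (w τ) f * gibbsCov (w τ) h w')) τ :=
  (hasDerivAt_gibbs hw _).fun_sub ((hasDerivAt_gibbs hw f).fun_mul (hasDerivAt_gibbs hw h))

/-- Convexity of the pressure: it lies above its tangents. -/
lemma logPart_add_ge [Nonempty S] (w h : S → ℝ) :
    logPart w + gibbs w h ≤ logPart (fun σ => w σ + h σ) := by
  have hZ := sum_exp_pos w
  have hZ' := sum_exp_pos fun σ => w σ + h σ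
  have key : (∑ σ, Real.exp (w σ)) * Real.exp (gibbs w h) ≤ ∑ σ, Real.exp (w σ + h σ) := by
    -- Jensen's inequality through `1 + x ≤ exp x`, with `x` the centred `h`, so that the linear
    -- term averages to zero.
    have h1 : gibbs w (fun σ => 1 + (h σ - gibbs w h))
        ≤ gibbs w (fun σ => Real.exp (h σ - gibbs w h)) :=
      gibbs_mono w fun σ => by linarith [Real.add_one_le_exp (h σ - gibbs w h)]
    have h2 : gibbs w (fun σ => 1 + (h σ - gibbs w h)) = 1 := by
      simp_rw [sub_eq_add_neg]
      rw [gibbs_add, gibbs_add, gibbs_const, gibbs_const]; ring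
    rw [h2, gibbs, le_div_iff₀ hZ, one_mul] at h1
    calc (∑ σ, Real.exp (w σ)) * Real.exp (gibbs w h)
        ≤ (∑ σ, Real.exp (h σ - gibbs w h) * Real.exp (w σ)) * Real.exp (gibbs w h) := by
          gcongr
      _ = _ := by
          rw [Finset.sum_mul]
          refine Finset.sum_congr rfl fun σ _ => ?_
          rw [← Real.exp_add, ← Real.exp_add]; congr 1; ring
  have := Real.log_le_log (by positivity) key
  rwa [Real.log_mul hZ.ne' (Real.exp_pos _).ne', Real.log_exp] at this

/-- The tangent bounds at `w'` and at `w` control the difference from the two sides by Gibbs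
averages of `w - w'`. -/
lemma abs_logPart_sub_le [Nonempty S] {w w' : S → ℝ} {C : ℝ} (hC : ∀ σ, |w σ - w' σ| ≤ C) :
    |logPart w - logPart w'| ≤ C := by
  have h1 := logPart_add_ge w' fun σ => w σ - w' σ
  have h2 := logPart_add_ge w fun σ => w' σ - w σ
  have e1 : (fun σ => w' σ + (w σ - w' σ)) = w := by ext; ring
  have e2 : (fun σ => w σ + (w' σ - w σ)) = w' := by ext; ring
  rw [e1] at h1
  rw [e2] at h2
  have b1 := abs_le.1 (abs_gibbs_le w' hC)
  have b2 := abs_le.1 (abs_gibbs_le w (f := fun σ => w' σ - w σ) (C := C)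
    fun σ => by rw [abs_sub_comm]; exact hC σ)
  rw [abs_le]
  constructor <;> linarith

lemma contDiff_gibbs [Nonempty S] {E : Type*} [NormedAddCommGroup E] [NormedSpace ℝ E]
    {n : WithTop ℕ∞} {w : E → S → ℝ} (hw : ∀ σ, ContDiff ℝ n fun x => w x σ) (f : S → ℝ) :
    ContDiff ℝ n fun x => gibbs (w x) f :=
  (ContDiff.sum fun σ _ => contDiff_const.mul (hw σ).exp).div (ContDiff.sum fun σ _ => (hw σ).exp)
    fun x => (sum_exp_pos (w x)).ne'

lemma continuous_gibbs [Nonempty S] {E : Type*} [TopologicalSpace E] {w : E → S → ℝ}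
    (hw : ∀ σ, Continuous fun x => w x σ) {f : E → S → ℝ} (hf : ∀ σ, Continuous fun x => f x σ) :
    Continuous fun x => gibbs (w x) (f x) :=
  (continuous_finsetSum _ fun σ _ => (hf σ).mul (hw σ).rexp).div
    (continuous_finsetSum _ fun σ _ => (hw σ).rexp) fun x => (sum_exp_pos (w x)).ne'

lemma continuous_logPart [Nonempty S] {E : Type*} [TopologicalSpace E] {w : E → S → ℝ}
    (hw : ∀ σ, Continuous fun x => w x σ) : Continuous fun x => logPart (w x) :=
  (continuous_finsetSum _ fun σ _ => (hw σ).rexp).log fun x => (sum_exp_pos (w x)).ne'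

lemma contDiff_gibbsCov [Nonempty S] {E : Type*} [NormedAddCommGroup E] [NormedSpace ℝ E]
    {n : WithTop ℕ∞} {w : E → S → ℝ} (hw : ∀ σ, ContDiff ℝ n fun x => w x σ) (f h : S → ℝ) :
    ContDiff ℝ n fun x => gibbsCov (w x) f h :=
  (contDiff_gibbs hw _).sub ((contDiff_gibbs hw f).mul (contDiff_gibbs hw h))

/-! ### Gaussian integration by parts for Gibbs averages. -/

section IntegrationByParts

variable {κ : Type*} [Fintype κ]

lemma abs_dotProduct_le (v g : κ → ℝ) : |v ⬝ᵥ g| ≤ (∑ k, |v k|) * ‖g‖ := by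
  refine (Finset.abs_sum_le_sum_abs _ _).trans ?_
  rw [Finset.sum_mul]
  refine Finset.sum_le_sum fun k _ => ?_
  rw [abs_mul]
  exact mul_le_mul_of_nonneg_left (norm_le_pi_norm g k) (abs_nonneg _)

lemma contDiff_dotProduct {n : WithTop ℕ∞} (v : κ → ℝ) : ContDiff ℝ n fun g => v ⬝ᵥ g :=
  ContDiff.sum fun k _ => contDiff_const.mul (contDiff_apply ℝ ℝ k)

lemma hasDerivAt_dotProduct_line (u g v : κ → ℝ) :
    HasDerivAt (fun τ : ℝ => u ⬝ᵥ (g + τ • v)) (u ⬝ᵥ v) 0 := by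
  simp only [dotProduct_add, dotProduct_smul, smul_eq_mul]
  simpa using ((hasDerivAt_id (0 : ℝ)).mul_const (u ⬝ᵥ v)).const_add (u ⬝ᵥ g)

/-- A Gibbs average whose Hamiltonian does not feel the direction `v` is orthogonal to `v ⬝ᵥ g`. -/
lemma integral_dotProduct_mul_gibbs [Nonempty S] (a : S → ℝ) (A : S → κ → ℝ) (f : S → ℝ)
    (v : κ → ℝ) (hv : ∀ σ, A σ ⬝ᵥ v = 0) :
    ∫ g, (v ⬝ᵥ g) * gibbs (fun σ => a σ + A σ ⬝ᵥ g) f ∂stdNormal κ = 0 := by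
  have hw : ∀ σ, ContDiff ℝ 1 fun g : κ → ℝ => a σ + A σ ⬝ᵥ g := fun σ =>
    contDiff_const.add (contDiff_dotProduct _)
  have key := integral_inner_mul_eq (F := fun g => gibbs (fun σ => a σ + A σ ⬝ᵥ g) f)
    (contDiff_gibbs hw f) (C := ∑ σ, |f σ|)
    (fun g => (abs_gibbs_le_sum _ f).trans (le_mul_of_one_le_right (by positivity)
      (by linarith [norm_nonneg g])))
    (D := fun g v => gibbsCov (fun σ => a σ + A σ ⬝ᵥ g) f fun σ => A σ ⬝ᵥ v)
    (fun g v => by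
      have := hasDerivAt_gibbs (w := fun (τ : ℝ) σ => a σ + A σ ⬝ᵥ (g + τ • v))
        (fun σ => (hasDerivAt_dotProduct_line (A σ) g v).const_add (a σ)) f
      simpa using this)
    (fun v => by
      obtain ⟨C, hC0, hC⟩ := exists_abs_gibbsCov_le f fun σ => A σ ⬝ᵥ v
      exact ⟨C, fun g => (hC _).trans (le_mul_of_one_le_right hC0 (by linarith [norm_nonneg g]))⟩) v
  simp only [hv, gibbsCov_zero, integral_zero] at key
  exact key

/-- Double Gaussian integration by parts for the product of two Gibbs averages, each of which is
blind to one of the two directions. -/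
lemma integral_dotProduct_mul_dotProduct_mul_gibbs [Nonempty S] (a₁ a₂ : S → ℝ)
    (A₁ A₂ : S → κ → ℝ) (f h : S → ℝ) (v u : κ → ℝ) (hv : ∀ σ, A₁ σ ⬝ᵥ v = 0)
    (hu : ∀ σ, A₂ σ ⬝ᵥ u = 0) :
    ∫ g, (v ⬝ᵥ g) * ((u ⬝ᵥ g) * (gibbs (fun σ => a₁ σ + A₁ σ ⬝ᵥ g) f *
        gibbs (fun σ => a₂ σ + A₂ σ ⬝ᵥ g) h)) ∂stdNormal κ
      = (u ⬝ᵥ v) * ∫ g, gibbs (fun σ => a₁ σ + A₁ σ ⬝ᵥ g) f *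
          gibbs (fun σ => a₂ σ + A₂ σ ⬝ᵥ g) h ∂stdNormal κ
        + ∫ g, gibbsCov (fun σ => a₁ σ + A₁ σ ⬝ᵥ g) f (fun σ => A₁ σ ⬝ᵥ u) *
          gibbsCov (fun σ => a₂ σ + A₂ σ ⬝ᵥ g) h (fun σ => A₂ σ ⬝ᵥ v) ∂stdNormal κ := by
  set w₁ : (κ → ℝ) → S → ℝ := fun g σ => a₁ σ + A₁ σ ⬝ᵥ g with hw₁
  set w₂ : (κ → ℝ) → S → ℝ := fun g σ => a₂ σ + A₂ σ ⬝ᵥ g with hw₂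
  have c₁ : ∀ σ, ContDiff ℝ 1 fun g => w₁ g σ := fun σ =>
    contDiff_const.add (contDiff_dotProduct _)
  have c₂ : ∀ σ, ContDiff ℝ 1 fun g => w₂ g σ := fun σ =>
    contDiff_const.add (contDiff_dotProduct _)
  have d₁ : ∀ g v σ, HasDerivAt (fun τ : ℝ => w₁ (g + τ • v) σ) (A₁ σ ⬝ᵥ v) 0 := fun g v σ =>
    (hasDerivAt_dotProduct_line (A₁ σ) g v).const_add (a₁ σ)
  have d₂ : ∀ g v σ, HasDerivAt (fun τ : ℝ => w₂ (g + τ • v) σ) (A₂ σ ⬝ᵥ v) 0 := fun g v σ =>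
    (hasDerivAt_dotProduct_line (A₂ σ) g v).const_add (a₂ σ)
  have bf : ∀ g, |gibbs (w₁ g) f| ≤ ∑ σ, |f σ| := fun g => abs_gibbs_le_sum _ f
  have bh : ∀ g, |gibbs (w₂ g) h| ≤ ∑ σ, |h σ| := fun g => abs_gibbs_le_sum _ h
  have e1 : ∀ g : κ → ℝ, 1 ≤ 1 + ‖g‖ := fun g => by linarith [norm_nonneg g]
  have bprod : ∀ g, |gibbs (w₁ g) f * gibbs (w₂ g) h| ≤ (∑ σ, |f σ|) * ∑ σ, |h σ| := fun g => by
    rw [abs_mul]; exact mul_le_mul (bf g) (bh g) (abs_nonneg _) (by positivity)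
  obtain ⟨C₂, hC₂0, hC₂⟩ := exists_abs_gibbsCov_le h fun σ => A₂ σ ⬝ᵥ v
  -- Integration by parts along `v` removes the factor `v ⬝ᵥ g`. By `hv` only `u ⬝ᵥ g` and the
  -- second Gibbs average feel this direction.
  have first := integral_inner_mul_eq (κ := κ)
    (F := fun g => (u ⬝ᵥ g) * (gibbs (w₁ g) f * gibbs (w₂ g) h))
    ((contDiff_dotProduct u).mul ((contDiff_gibbs c₁ f).mul (contDiff_gibbs c₂ h)))
    (C := (∑ k, |u k|) * ((∑ σ, |f σ|) * ∑ σ, |h σ|))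
    (fun g => by
      rw [abs_mul, mul_right_comm]
      refine mul_le_mul ((abs_dotProduct_le u g).trans ?_) (bprod g) (abs_nonneg _) (by positivity)
      gcongr; linarith)
    (D := fun g v => (u ⬝ᵥ v) * (gibbs (w₁ g) f * gibbs (w₂ g) h) + (u ⬝ᵥ g) *
      (gibbsCov (w₁ g) f (fun σ => A₁ σ ⬝ᵥ v) * gibbs (w₂ g) h +
        gibbs (w₁ g) f * gibbsCov (w₂ g) h (fun σ => A₂ σ ⬝ᵥ v)))
    (fun g v => by
      have := (hasDerivAt_dotProduct_line u g v).fun_mul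
        ((hasDerivAt_gibbs (d₁ g v) f).fun_mul (hasDerivAt_gibbs (d₂ g v) h))
      simpa using this)
    (fun v => by
      obtain ⟨B₁, hB₁0, hB₁⟩ := exists_abs_gibbsCov_le f fun σ => A₁ σ ⬝ᵥ v
      obtain ⟨B₂, hB₂0, hB₂⟩ := exists_abs_gibbsCov_le h fun σ => A₂ σ ⬝ᵥ v
      refine ⟨|u ⬝ᵥ v| * ((∑ σ, |f σ|) * ∑ σ, |h σ|) +
        (∑ k, |u k|) * (B₁ * (∑ σ, |h σ|) + (∑ σ, |f σ|) * B₂), fun g => ?_⟩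
      rw [add_mul]
      refine (abs_add_le _ _).trans (add_le_add ?_ ?_)
      · rw [abs_mul]
        refine (mul_le_mul_of_nonneg_left (bprod g) (abs_nonneg _)).trans ?_
        exact le_mul_of_one_le_right (by positivity) (e1 g)
      · rw [abs_mul, mul_right_comm]
        refine mul_le_mul ((abs_dotProduct_le u g).trans ?_) ?_ (abs_nonneg _) (by positivity)
        · gcongr; linarith
        · refine (abs_add_le _ _).trans (add_le_add ?_ ?_)
          · rw [abs_mul]; exact mul_le_mul (hB₁ _) (bh g) (abs_nonneg _) hB₁0
          · rw [abs_mul]; exact mul_le_mul (bf g) (hB₂ _) (abs_nonneg _) (by positivity))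
    v
  -- The remaining term still contains `u ⬝ᵥ g`, removed by integration by parts along `u`. By `hu`
  -- all derivatives of the second factor, including those of its truncated correlation, vanish.
  have second := integral_inner_mul_eq (κ := κ)
    (F := fun g => gibbs (w₁ g) f * gibbsCov (w₂ g) h (fun σ => A₂ σ ⬝ᵥ v))
    ((contDiff_gibbs c₁ f).mul (contDiff_gibbsCov c₂ h _))
    (C := (∑ σ, |f σ|) * C₂)
    (fun g => by
      rw [abs_mul]
      exact (mul_le_mul (bf g) (hC₂ _) (abs_nonneg _) (by positivity)).trans
        (le_mul_of_one_le_right (by positivity) (e1 g)))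
    (D := fun g u => gibbsCov (w₁ g) f (fun σ => A₁ σ ⬝ᵥ u) *
        gibbsCov (w₂ g) h (fun σ => A₂ σ ⬝ᵥ v) + gibbs (w₁ g) f *
        (gibbsCov (w₂ g) (fun σ => h σ * A₂ σ ⬝ᵥ v) (fun σ => A₂ σ ⬝ᵥ u)
        - (gibbsCov (w₂ g) h (fun σ => A₂ σ ⬝ᵥ u) * gibbs (w₂ g) (fun σ => A₂ σ ⬝ᵥ v) +
          gibbs (w₂ g) h * gibbsCov (w₂ g) (fun σ => A₂ σ ⬝ᵥ v) (fun σ => A₂ σ ⬝ᵥ u))))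
    (fun g u => by
      have := (hasDerivAt_gibbs (d₁ g u) f).fun_mul
        (hasDerivAt_gibbsCov (d₂ g u) h fun σ => A₂ σ ⬝ᵥ v)
      simpa using this)
    (fun u => by
      obtain ⟨B₁, hB₁0, hB₁⟩ := exists_abs_gibbsCov_le f fun σ => A₁ σ ⬝ᵥ u
      obtain ⟨B₂, hB₂0, hB₂⟩ := exists_abs_gibbsCov_le h fun σ => A₂ σ ⬝ᵥ u
      obtain ⟨B₃, hB₃0, hB₃⟩ := exists_abs_gibbsCov_le (fun σ => h σ * A₂ σ ⬝ᵥ v)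
        fun σ => A₂ σ ⬝ᵥ u
      obtain ⟨B₄, hB₄0, hB₄⟩ := exists_abs_gibbsCov_le (fun σ => A₂ σ ⬝ᵥ v) fun σ => A₂ σ ⬝ᵥ u
      refine ⟨B₁ * C₂ + (∑ σ, |f σ|) *
        (B₃ + (B₂ * (∑ σ, |A₂ σ ⬝ᵥ v|) + (∑ σ, |h σ|) * B₄)), fun g => ?_⟩
      refine le_trans ?_ (le_mul_of_one_le_right (by positivity) (e1 g))
      refine (abs_add_le _ _).trans (add_le_add ?_ ?_)
      · rw [abs_mul]; exact mul_le_mul (hB₁ _) (hC₂ _) (abs_nonneg _) hB₁0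
      · rw [abs_mul]
        refine mul_le_mul (bf g) ?_ (abs_nonneg _) (by positivity)
        refine (abs_sub _ _).trans (add_le_add (hB₃ _) ?_)
        refine (abs_add_le _ _).trans (add_le_add ?_ ?_)
        · rw [abs_mul]; exact mul_le_mul (hB₂ _) (abs_gibbs_le_sum _ _) (abs_nonneg _) hB₂0
        · rw [abs_mul]; exact mul_le_mul (bh g) (hB₄ _) (abs_nonneg _) (by positivity))
    u
  simp only [hu, gibbsCov_zero, zero_mul, mul_zero, add_zero, sub_zero] at second
  simp only [hv, gibbsCov_zero, zero_mul, zero_add] at first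
  change ∫ g, (v ⬝ᵥ g) * ((u ⬝ᵥ g) * (gibbs (w₁ g) f * gibbs (w₂ g) h)) ∂stdNormal κ = _ at first
  change ∫ g, (u ⬝ᵥ g) * (gibbs (w₁ g) f * gibbsCov (w₂ g) h _) ∂stdNormal κ = _ at second
  have k₁ := (contDiff_gibbs c₁ f).continuous
  have k₂ := (contDiff_gibbs c₂ h).continuous
  have k₃ := (contDiff_gibbsCov c₂ h fun σ => A₂ σ ⬝ᵥ v).continuous
  have k₄ : Continuous fun g => u ⬝ᵥ g := (contDiff_dotProduct (n := 0) u).continuous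
  rw [first, integral_add, integral_const_mul, second]
  · refine (integrable_of_linear_growth (by fun_prop) (C := (∑ σ, |f σ|) * ∑ σ, |h σ|)
      fun g => (bprod g).trans (le_mul_of_one_le_right (by positivity) (e1 g))).const_mul _
  · refine integrable_of_linear_growth (by fun_prop)
      (C := (∑ k, |u k|) * ((∑ σ, |f σ|) * C₂)) fun g => ?_
    rw [abs_mul, mul_right_comm]
    refine mul_le_mul ((abs_dotProduct_le u g).trans ?_) ?_ (abs_nonneg _) (by positivity)
    · gcongr; linarith
    · rw [abs_mul]; exact mul_le_mul (bf g) (hC₂ _) (abs_nonneg _) (by positivity)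

end IntegrationByParts

end Gibbs

/-! ### Integrals depending on parameters, and elementary variance inequalities. -/

section Parametric

variable {κ : Type*} [Fintype κ]

lemma continuous_integral_stdNormal {P : Type*} [TopologicalSpace P] [FirstCountableTopology P]
    {f : P → (κ → ℝ) → ℝ} (hf : Continuous (Function.uncurry f)) {C : ℝ}
    (hC : ∀ p g, |f p g| ≤ C * (1 + ‖g‖) ^ 2) :
    Continuous fun p => ∫ g, f p g ∂stdNormal κ :=
  continuous_of_dominated (fun p => (hf.uncurry_left p).aestronglyMeasurable)
    (fun p => ae_of_all _ (hC p)) (integrable_one_add_norm_sq.const_mul C)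
    (ae_of_all _ fun g => hf.uncurry_right g)

lemma integral_intervalIntegral_swap {f : ℝ → (κ → ℝ) → ℝ} (hf : Continuous (Function.uncurry f))
    {C : ℝ} (hC : ∀ t g, |f t g| ≤ C * (1 + ‖g‖) ^ 2) (a b : ℝ) :
    ∫ g, (∫ t in a..b, f t g) ∂stdNormal κ = ∫ t in a..b, ∫ g, f t g ∂stdNormal κ := by
  refine (intervalIntegral_integral_swap ?_).symm
  have : IsFiniteMeasure (volume.restrict (Set.uIoc a b)) := ⟨by simp [Set.uIoc]⟩
  have : Integrable (fun p : ℝ × (κ → ℝ) => C * (1 + ‖p.2‖) ^ 2)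
      ((volume.restrict (Set.uIoc a b)).prod (stdNormal κ)) :=
    (integrable_one_add_norm_sq.const_mul C).comp_snd _
  exact this.mono' hf.aestronglyMeasurable (ae_of_all _ fun p => hC p.1 p.2)

lemma continuous_intervalIntegral {E : Type*} [TopologicalSpace E] {f : ℝ → E → ℝ}
    (hf : Continuous (Function.uncurry f)) (a b : ℝ) :
    Continuous fun x => ∫ t in a..b, f t x :=
  intervalIntegral.continuous_parametric_intervalIntegral_of_continuous'
    (f := fun x t => f t x) (hf.comp continuous_swap) a b

lemma abs_intervalIntegral_le {f : ℝ → ℝ} {C : ℝ} (hC : ∀ t, |f t| ≤ C) {a b : ℝ} (hab : a ≤ b) :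
    |∫ t in a..b, f t| ≤ C * (b - a) := by
  have := intervalIntegral.norm_integral_le_of_norm_le_const (a := a) (b := b) (f := f) (C := C)
    fun x _ => hC x
  rwa [abs_of_nonneg (sub_nonneg.2 hab)] at this

/-- Cauchy–Schwarz, obtained from the nonnegative integral of the squared deviation of `f` from its
mean over the interval. -/
lemma sq_intervalIntegral_le {f : ℝ → ℝ} (hf : Continuous f) {a b : ℝ} (hab : a ≤ b) :
    (∫ t in a..b, f t) ^ 2 ≤ (b - a) * ∫ t in a..b, f t ^ 2 := by
  rcases hab.eq_or_lt with rfl | hlt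
  · simp
  have hba : 0 < b - a := sub_pos.2 hlt
  set A := ∫ t in a..b, f t with hA
  have h0 : 0 ≤ ∫ t in a..b, (f t - A / (b - a)) ^ 2 :=
    intervalIntegral.integral_nonneg hab fun _ _ => sq_nonneg _
  have h1 : ∫ t in a..b, (f t - A / (b - a)) ^ 2
      = (∫ t in a..b, f t ^ 2) - 2 * (A / (b - a)) * A + (b - a) * (A / (b - a)) ^ 2 := by
    have e : ∀ t, (f t - A / (b - a)) ^ 2
        = f t ^ 2 - 2 * (A / (b - a)) * f t + (A / (b - a)) ^ 2 := fun t => by ring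
    simp_rw [e]
    rw [intervalIntegral.integral_add, intervalIntegral.integral_sub,
      intervalIntegral.integral_const_mul, intervalIntegral.integral_const, smul_eq_mul]
    all_goals exact Continuous.intervalIntegrable (by fun_prop) _ _
  rw [h1] at h0
  have h2 : (∫ t in a..b, f t ^ 2) - 2 * (A / (b - a)) * A + (b - a) * (A / (b - a)) ^ 2
      = (∫ t in a..b, f t ^ 2) - A ^ 2 / (b - a) := by field_simp; ring
  rw [h2, sub_nonneg, div_le_iff₀ hba] at h0
  linarith

end Parametric

section Variance

variable {Ω : Type*} [MeasurableSpace Ω] {P : Measure Ω} [IsProbabilityMeasure P]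

lemma variance_add_le {X Y : Ω → ℝ} (hX : MemLp X 2 P) (hY : MemLp Y 2 P) :
    Var[fun ω => X ω + Y ω; P] ≤ 2 * Var[X; P] + 2 * Var[Y; P] := by
  have h1 := variance_fun_add hX hY
  have h2 := variance_fun_sub hX hY
  have h3 := variance_nonneg (fun ω => X ω - Y ω) P
  linarith

lemma variance_sub_le {X Y : Ω → ℝ} (hX : MemLp X 2 P) (hY : MemLp Y 2 P) :
    Var[fun ω => X ω - Y ω; P] ≤ 2 * Var[X; P] + 2 * Var[Y; P] := by
  have h1 := variance_fun_add hX hY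
  have h2 := variance_fun_sub hX hY
  have h3 := variance_nonneg (fun ω => X ω + Y ω) P
  linarith

lemma variance_le_add_integral_sq {X Y : Ω → ℝ} (hX : MemLp X 2 P) (hY : MemLp Y 2 P) :
    Var[X; P] ≤ 2 * Var[Y; P] + 2 * ∫ ω, (X ω - Y ω) ^ 2 ∂P := by
  have h := variance_add_le hY (hX.sub hY)
  have e : (fun ω => Y ω + (X - Y) ω) = X := by ext; simp
  rw [e] at h
  have := variance_le_expectation_sq (hX.sub hY).aestronglyMeasurable
  simp only [Pi.pow_apply, Pi.sub_apply] at this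
  linarith

end Variance

/-! ### An abstract spin system with rotated Gaussian couplings. -/

lemma abs_cos_add_sin_le (t : ℝ) : |Real.cos t + Real.sin t| ≤ 2 :=
  (abs_add_le _ _).trans (by linarith [Real.abs_cos_le_one t, Real.abs_sin_le_one t])

/-- A finite spin system with Gaussian couplings indexed by `ι`, whose couplings in `inner` are
rotated. -/
structure RotatedModel (S ι : Type*) where
  /-- The inverse temperature. -/
  β : ℝ
  /-- The spin products. -/
  spin : S → ι → ℝ
  /-- The rotated couplings. -/
  inner : Finset ι
  /-- The standard deviations. -/
  Δ : ι → ℝ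
  /-- The means of the couplings that are not rotated. -/
  m : ι → ℝ
  /-- The means of the rotated couplings, up to the scale `μ`. -/
  m' : ι → ℝ
  abs_spin_le : ∀ σ X, |spin σ X| ≤ 1

namespace RotatedModel

section Exponent

variable {S ι : Type*} (M : RotatedModel S ι)

/-- The magnetization conjugate to `μ`. -/
def meanIn (σ : S) : ℝ := ∑ X ∈ M.inner, M.m' X * M.spin σ X

/-- The total mean of the rotated couplings. -/
def totalMean : ℝ := ∑ X ∈ M.inner, |M.m' X|

lemma abs_meanIn_le (σ : S) : |M.meanIn σ| ≤ M.totalMean := by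
  refine (Finset.abs_sum_le_sum_abs _ _).trans (Finset.sum_le_sum fun X _ => ?_)
  rw [abs_mul]
  exact mul_le_of_le_one_right (abs_nonneg _) (M.abs_spin_le σ X)

lemma lipschitz_coeff_nonneg (k : ι ⊕ ι) :
    0 ≤ (Sum.elim (fun X => |M.β| * |M.Δ X|) fun X => |M.β| * |M.Δ X|) k := by
  rcases k with X | X <;> simp only [Sum.elim_inl, Sum.elim_inr] <;> positivity

lemma totalMean_nonneg : 0 ≤ M.totalMean := Finset.sum_nonneg fun _ _ => abs_nonneg _

variable [Fintype ι]

/-- The total variance of the couplings. -/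
def totalVar : ℝ := ∑ X, M.Δ X ^ 2

lemma totalVar_nonneg : 0 ≤ M.totalVar := Finset.sum_nonneg fun _ _ => sq_nonneg _

variable [DecidableEq ι]

/-- The velocity of the rotation of the coupling `X`. -/
def dir (t : ℝ) (X : ι) : ι ⊕ ι → ℝ :=
  Sum.elim (Pi.single X (-(M.Δ X * Real.sin t))) (Pi.single X (M.Δ X * Real.cos t))

/-- The coefficients of the Gaussian variables in the exponent. -/
def coeff (t : ℝ) (σ : S) : ι ⊕ ι → ℝ :=
  Sum.elim (fun X => if X ∈ M.inner then M.β * M.spin σ X * M.Δ X * Real.cos t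
    else M.β * M.spin σ X * M.Δ X)
    (fun X => if X ∈ M.inner then M.β * M.spin σ X * M.Δ X * Real.sin t else 0)

/-- The deterministic part of the exponent. -/
def drift (μ t : ℝ) (σ : S) : ℝ :=
  M.β * ((Real.cos t + Real.sin t) * μ * M.meanIn σ + ∑ X ∈ M.innerᶜ, M.m X * M.spin σ X)

/-- The exponent of the Gibbs weight. -/
def logw (μ t : ℝ) (g : ι ⊕ ι → ℝ) (σ : S) : ℝ := M.drift μ t σ + M.coeff t σ ⬝ᵥ g

lemma dir_dotProduct (t : ℝ) (X : ι) (g : ι ⊕ ι → ℝ) : M.dir t X ⬝ᵥ g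
    = M.Δ X * (-Real.sin t * g (Sum.inl X) + Real.cos t * g (Sum.inr X)) := by
  simp [dir, dotProduct, Pi.single_apply, Finset.sum_ite_eq']
  ring

/-- The planar vectors `(cos s, sin s)` and `(-sin t, cos t)` have inner product `-sin (t - s)`. At
`s = t` it vanishes: the exponent at time `t` does not feel the velocity of the rotation at that
time. -/
lemma coeff_dotProduct_dir (t s : ℝ) (σ : S) {X : ι} (hX : X ∈ M.inner) :
    M.coeff s σ ⬝ᵥ M.dir t X = -(M.β * Real.sin (t - s) * M.Δ X ^ 2) * M.spin σ X := by
  rw [dotProduct_comm, dir_dotProduct, Real.sin_sub]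
  simp only [coeff, Sum.elim_inl, Sum.elim_inr, if_pos hX]
  ring

lemma dir_dotProduct_dir (t s : ℝ) (X Y : ι) :
    M.dir s Y ⬝ᵥ M.dir t X = if X = Y then M.Δ X ^ 2 * Real.cos (t - s) else 0 := by
  rw [dir_dotProduct, Real.cos_sub]
  split_ifs with h
  · subst h
    simp [dir]; ring
  · simp [dir, Ne.symm h]

lemma abs_dir_dotProduct_le (t : ℝ) (X : ι) (g : ι ⊕ ι → ℝ) :
    |M.dir t X ⬝ᵥ g| ≤ 2 * |M.Δ X| * (1 + ‖g‖) := by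
  rw [dir_dotProduct, abs_mul]
  have h1 : |-Real.sin t * g (Sum.inl X)| ≤ ‖g‖ := by
    rw [abs_mul, abs_neg]
    exact (mul_le_of_le_one_left (abs_nonneg _) (Real.abs_sin_le_one t)).trans (norm_le_pi_norm g _)
  have h2 : |Real.cos t * g (Sum.inr X)| ≤ ‖g‖ := by
    rw [abs_mul]
    exact (mul_le_of_le_one_left (abs_nonneg _) (Real.abs_cos_le_one t)).trans (norm_le_pi_norm g _)
  have h3 := abs_add_le (-Real.sin t * g (Sum.inl X)) (Real.cos t * g (Sum.inr X))
  have : |-Real.sin t * g (Sum.inl X) + Real.cos t * g (Sum.inr X)| ≤ 2 * (1 + ‖g‖) := by linarith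
  calc _ ≤ |M.Δ X| * (2 * (1 + ‖g‖)) := mul_le_mul_of_nonneg_left this (abs_nonneg _)
    _ = _ := by ring

lemma continuous_logw (σ : S) :
    Continuous fun p : ℝ × ℝ × (ι ⊕ ι → ℝ) => M.logw p.1 p.2.1 p.2.2 σ := by
  have h : ∀ k : ι ⊕ ι, Continuous fun p : ℝ × ℝ × (ι ⊕ ι → ℝ) => M.coeff p.2.1 σ k := by
    rintro (X | X) <;> simp only [coeff, Sum.elim_inl, Sum.elim_inr] <;> split_ifs <;> fun_prop
  unfold logw drift dotProduct
  have h' : Continuous fun p : ℝ × ℝ × (ι ⊕ ι → ℝ) => ∑ k, M.coeff p.2.1 σ k * p.2.2 k :=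
    continuous_finsetSum _ fun k _ => (h k).mul (by fun_prop)
  fun_prop

lemma logw_add (μ δ t : ℝ) (g : ι ⊕ ι → ℝ) : M.logw (μ + δ) t g
    = fun σ => M.logw μ t g σ + δ * (M.β * (Real.cos t + Real.sin t)) * M.meanIn σ := by
  ext σ; simp only [logw, drift]; ring

end Exponent

/-! ### Mean and covariance of the averaged velocity. -/

section Model

variable {S ι : Type*} [Fintype S] [Nonempty S] [Fintype ι] [DecidableEq ι] (M : RotatedModel S ι)

/-- The Gibbs average of the spin product `X`. -/
def mag (μ t : ℝ) (g : ι ⊕ ι → ℝ) (X : ι) : ℝ := gibbs (M.logw μ t g) fun σ => M.spin σ X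

/-- The truncated correlation of two spin products. -/
def corr (μ t : ℝ) (g : ι ⊕ ι → ℝ) (X Y : ι) : ℝ :=
  gibbsCov (M.logw μ t g) (fun σ => M.spin σ X) fun σ => M.spin σ Y

/-- The Gibbs average of the velocity of the centred energy. -/
def speed (μ t : ℝ) (g : ι ⊕ ι → ℝ) : ℝ := ∑ X ∈ M.inner, (M.dir t X ⬝ᵥ g) * M.mag μ t g X

/-- The Gibbs average of the magnetization conjugate to `μ`. -/
def magIn (μ t : ℝ) (g : ι ⊕ ι → ℝ) : ℝ := gibbs (M.logw μ t g) M.meanIn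

/-- The pressure. -/
def press (μ t : ℝ) (g : ι ⊕ ι → ℝ) : ℝ := logPart (M.logw μ t g)

/-- The mean overlap of two replicas. -/
def overlap (μ t s : ℝ) : ℝ :=
  ∫ g, ∑ X ∈ M.inner, M.Δ X ^ 2 * (M.mag μ t g X * M.mag μ s g X) ∂stdNormal (ι ⊕ ι)

/-- The mean product of the truncated correlations of two replicas. -/
def replicon (μ t s : ℝ) : ℝ :=
  ∫ g, ∑ X ∈ M.inner, ∑ Y ∈ M.inner, M.Δ X ^ 2 * M.Δ Y ^ 2 * (M.corr μ t g X Y * M.corr μ s g X Y)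
    ∂stdNormal (ι ⊕ ι)

lemma continuous_gibbs_logw (f : S → ℝ) :
    Continuous fun p : ℝ × ℝ × (ι ⊕ ι → ℝ) => gibbs (M.logw p.1 p.2.1 p.2.2) f :=
  continuous_gibbs M.continuous_logw fun _ => continuous_const

lemma continuous_mag (X : ι) :
    Continuous fun p : ℝ × ℝ × (ι ⊕ ι → ℝ) => M.mag p.1 p.2.1 p.2.2 X :=
  M.continuous_gibbs_logw _

lemma continuous_corr (X Y : ι) :
    Continuous fun p : ℝ × ℝ × (ι ⊕ ι → ℝ) => M.corr p.1 p.2.1 p.2.2 X Y :=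
  (M.continuous_gibbs_logw _).sub ((M.continuous_gibbs_logw _).mul (M.continuous_gibbs_logw _))

lemma continuous_magIn : Continuous fun p : ℝ × ℝ × (ι ⊕ ι → ℝ) => M.magIn p.1 p.2.1 p.2.2 :=
  M.continuous_gibbs_logw _

lemma continuous_speed : Continuous fun p : ℝ × ℝ × (ι ⊕ ι → ℝ) => M.speed p.1 p.2.1 p.2.2 := by
  unfold speed
  simp_rw [dir_dotProduct]
  exact continuous_finsetSum _ fun X _ => Continuous.mul (by fun_prop) (M.continuous_mag X)

lemma abs_mag_le (μ t : ℝ) (g : ι ⊕ ι → ℝ) (X : ι) : |M.mag μ t g X| ≤ 1 :=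
  abs_gibbs_le _ fun σ => M.abs_spin_le σ X

lemma abs_corr_le (μ t : ℝ) (g : ι ⊕ ι → ℝ) (X Y : ι) : |M.corr μ t g X Y| ≤ 2 := by
  have h1 : |gibbs (M.logw μ t g) fun σ => M.spin σ X * M.spin σ Y| ≤ 1 :=
    abs_gibbs_le _ fun σ => by
      rw [abs_mul]; exact mul_le_one₀ (M.abs_spin_le σ X) (abs_nonneg _) (M.abs_spin_le σ Y)
  have h2 : |M.mag μ t g X * M.mag μ t g Y| ≤ 1 := by
    rw [abs_mul]; exact mul_le_one₀ (M.abs_mag_le μ t g X) (abs_nonneg _) (M.abs_mag_le μ t g Y)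
  refine (abs_sub _ _).trans ?_
  exact (add_le_add h1 h2).trans (by norm_num)

lemma abs_magIn_le (μ t : ℝ) (g : ι ⊕ ι → ℝ) : |M.magIn μ t g| ≤ M.totalMean :=
  abs_gibbs_le _ M.abs_meanIn_le

lemma abs_speed_le (μ t : ℝ) (g : ι ⊕ ι → ℝ) :
    |M.speed μ t g| ≤ (∑ X ∈ M.inner, 2 * |M.Δ X|) * (1 + ‖g‖) := by
  refine (Finset.abs_sum_le_sum_abs _ _).trans ?_
  rw [Finset.sum_mul]
  refine Finset.sum_le_sum fun X _ => ?_
  rw [abs_mul]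
  exact (mul_le_of_le_one_right (abs_nonneg _) (M.abs_mag_le μ t g X)).trans
    (M.abs_dir_dotProduct_le t X g)

/-- Integration by parts leaves no term, because the direction of motion is orthogonal to the
coefficients at the same time. -/
lemma integral_speed (μ t : ℝ) : ∫ g, M.speed μ t g ∂stdNormal (ι ⊕ ι) = 0 := by
  unfold speed
  rw [integral_finsetSum]
  · refine Finset.sum_eq_zero fun X hX => ?_
    refine integral_dotProduct_mul_gibbs (M.drift μ t) (M.coeff t) _ (M.dir t X) fun σ => ?_
    rw [M.coeff_dotProduct_dir t t σ hX]; simp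
  · intro X _
    refine integrable_of_linear_growth (Continuous.aestronglyMeasurable ?_) (C := 2 * |M.Δ X|)
      fun g => ?_
    · simp_rw [dir_dotProduct]
      exact Continuous.mul (by fun_prop)
        ((M.continuous_mag X).comp (f := fun g => (μ, t, g)) (by fun_prop))
    · rw [abs_mul]
      exact (mul_le_of_le_one_right (abs_nonneg _) (M.abs_mag_le μ t g X)).trans
        (M.abs_dir_dotProduct_le t X g)

/-- Contracting the two velocities with each other gives the overlap with factor `cos (t - s)`.
Contracting each velocity with the exponent at the other time gives a product of truncated
correlations, and the opposite signs of `sin (t - s)` and `sin (s - t)` produce the minus sign. -/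
lemma integral_speed_mul_speed (μ t s : ℝ) :
    ∫ g, M.speed μ t g * M.speed μ s g ∂stdNormal (ι ⊕ ι)
      = Real.cos (t - s) * M.overlap μ t s
        - M.β ^ 2 * (Real.sin (t - s) ^ 2 * M.replicon μ t s) := by
  have cm : ∀ t X, Continuous fun g => M.mag μ t g X := fun t X =>
    (M.continuous_mag X).comp (f := fun g => (μ, t, g)) (by fun_prop)
  have cc : ∀ t X Y, Continuous fun g => M.corr μ t g X Y := fun t X Y =>
    (M.continuous_corr X Y).comp (f := fun g => (μ, t, g)) (by fun_prop)
  have cd : ∀ t X, Continuous fun g => M.dir t X ⬝ᵥ g := fun t X => by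
    simp_rw [dir_dotProduct]; fun_prop
  have term : ∀ X ∈ M.inner, ∀ Y ∈ M.inner,
      ∫ g, (M.dir t X ⬝ᵥ g) * M.mag μ t g X * ((M.dir s Y ⬝ᵥ g) * M.mag μ s g Y)
        ∂stdNormal (ι ⊕ ι)
      = (if X = Y then M.Δ X ^ 2 * Real.cos (t - s) else 0)
          * ∫ g, M.mag μ t g X * M.mag μ s g Y ∂stdNormal (ι ⊕ ι)
        - M.β ^ 2 * (Real.sin (t - s) ^ 2 * (M.Δ X ^ 2 * M.Δ Y ^ 2 *
          ∫ g, M.corr μ t g X Y * M.corr μ s g X Y ∂stdNormal (ι ⊕ ι))) := by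
    intro X hX Y hY
    have := integral_dotProduct_mul_dotProduct_mul_gibbs (M.drift μ t) (M.drift μ s) (M.coeff t)
      (M.coeff s) (fun σ => M.spin σ X) (fun σ => M.spin σ Y) (M.dir t X) (M.dir s Y)
      (fun σ => by rw [M.coeff_dotProduct_dir t t σ hX]; simp)
      (fun σ => by rw [M.coeff_dotProduct_dir s s σ hY]; simp)
    simp only [M.coeff_dotProduct_dir _ _ _ hX, M.coeff_dotProduct_dir _ _ _ hY,
      gibbsCov_const_mul, dir_dotProduct_dir] at this
    have e1 : ∀ g : ι ⊕ ι → ℝ,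
        (M.dir t X ⬝ᵥ g) * M.mag μ t g X * ((M.dir s Y ⬝ᵥ g) * M.mag μ s g Y)
        = (M.dir t X ⬝ᵥ g) * ((M.dir s Y ⬝ᵥ g) * (M.mag μ t g X * M.mag μ s g Y)) :=
      fun g => by ring
    simp_rw [e1]
    refine this.trans ?_
    rw [sub_eq_add_neg]
    congr 1
    rw [← integral_const_mul, ← integral_const_mul, ← integral_const_mul, ← integral_neg]
    refine integral_congr_ae (ae_of_all _ fun g => ?_)
    have e2 : gibbsCov (fun σ => M.drift μ s σ + M.coeff s σ ⬝ᵥ g) (fun σ => M.spin σ Y)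
        (fun σ => M.spin σ X) = M.corr μ s g X Y := gibbsCov_comm _ _ _
    have e3 : gibbsCov (fun σ => M.drift μ t σ + M.coeff t σ ⬝ᵥ g) (fun σ => M.spin σ X)
        (fun σ => M.spin σ Y) = M.corr μ t g X Y := rfl
    have e4 : Real.sin (s - t) = -Real.sin (t - s) := by rw [← Real.sin_neg, neg_sub]
    simp only [e2, e3, e4]
    ring_nf
  have hi : ∀ X ∈ M.inner, ∀ Y ∈ M.inner, Integrable (fun g => (M.dir t X ⬝ᵥ g) * M.mag μ t g X
      * ((M.dir s Y ⬝ᵥ g) * M.mag μ s g Y)) (stdNormal (ι ⊕ ι)) := by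
    intro X _ Y _
    refine integrable_of_growth (Continuous.aestronglyMeasurable ?_)
      (C := 2 * |M.Δ X| * (2 * |M.Δ Y|)) fun g => ?_
    · exact ((cd t X).mul (cm t X)).mul ((cd s Y).mul (cm s Y))
    · rw [abs_mul, abs_mul, abs_mul]
      have h1 := (mul_le_of_le_one_right (abs_nonneg _) (M.abs_mag_le μ t g X)).trans
        (M.abs_dir_dotProduct_le t X g)
      have h2 := (mul_le_of_le_one_right (abs_nonneg _) (M.abs_mag_le μ s g Y)).trans
        (M.abs_dir_dotProduct_le s Y g)
      calc _ ≤ (2 * |M.Δ X| * (1 + ‖g‖)) * (2 * |M.Δ Y| * (1 + ‖g‖)) :=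
            mul_le_mul h1 h2 (by positivity) (by positivity)
        _ = _ := by ring
  have io : ∀ X ∈ M.inner, Integrable (fun g => M.Δ X ^ 2 * (M.mag μ t g X * M.mag μ s g X))
      (stdNormal (ι ⊕ ι)) := by
    intro X _
    refine Integrable.const_mul (Integrable.of_bound
      ((cm t X).fun_mul (cm s X)).aestronglyMeasurable 1 (ae_of_all _ fun g => ?_)) _
    rw [Real.norm_eq_abs, abs_mul]
    exact mul_le_one₀ (M.abs_mag_le μ t g X) (abs_nonneg _) (M.abs_mag_le μ s g X)
  have ir : ∀ X ∈ M.inner, ∀ Y ∈ M.inner, Integrable (fun g => M.Δ X ^ 2 * M.Δ Y ^ 2 *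
      (M.corr μ t g X Y * M.corr μ s g X Y)) (stdNormal (ι ⊕ ι)) := by
    intro X _ Y _
    refine Integrable.const_mul (Integrable.of_bound
      ((cc t X Y).fun_mul (cc s X Y)).aestronglyMeasurable (2 * 2) (ae_of_all _ fun g => ?_)) _
    rw [Real.norm_eq_abs, abs_mul]
    exact mul_le_mul (M.abs_corr_le μ t g X Y) (M.abs_corr_le μ s g X Y) (abs_nonneg _) zero_le_two
  unfold speed overlap replicon
  simp_rw [Finset.sum_mul_sum]
  rw [integral_finsetSum _ fun X hX => integrable_finsetSum _ fun Y hY => hi X hX Y hY,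
    integral_finsetSum _ io,
    integral_finsetSum _ fun X hX => integrable_finsetSum _ fun Y hY => ir X hX Y hY]
  simp_rw [Finset.mul_sum]
  rw [← Finset.sum_sub_distrib]
  refine Finset.sum_congr rfl fun X hX => ?_
  rw [integral_finsetSum _ fun Y hY => hi X hX Y hY, integral_finsetSum _ fun Y hY => ir X hX Y hY,
    Finset.sum_congr rfl fun Y hY => term X hX Y hY, Finset.sum_sub_distrib]
  congr 1
  · simp only [ite_mul, zero_mul, Finset.sum_ite_eq, hX, if_true]
    rw [integral_const_mul]; ring
  · simp_rw [Finset.mul_sum, integral_const_mul]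

end Model


/-! ### Fluctuations of the pressure and self-averaging of the magnetization conjugate to `μ`. -/

section Model

variable {S ι : Type*} [Fintype S] [Nonempty S] [Fintype ι] [DecidableEq ι] (M : RotatedModel S ι)

lemma abs_press_sub_le (μ t : ℝ) (g g' : ι ⊕ ι → ℝ) :
    |M.press μ t g - M.press μ t g'|
      ≤ ∑ k, (Sum.elim (fun X => |M.β| * |M.Δ X|) fun X => |M.β| * |M.Δ X|) k * |g k - g' k| := by
  refine abs_logPart_sub_le fun σ => ?_
  have e : M.logw μ t g σ - M.logw μ t g' σ = ∑ k, M.coeff t σ k * (g k - g' k) := by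
    simp only [logw, dotProduct, mul_sub, Finset.sum_sub_distrib]; ring
  rw [e]
  refine (Finset.abs_sum_le_sum_abs _ _).trans (Finset.sum_le_sum fun k _ => ?_)
  rw [abs_mul]
  refine mul_le_mul_of_nonneg_right ?_ (abs_nonneg _)
  have h1 : ∀ X, |M.β * M.spin σ X * M.Δ X| ≤ |M.β| * |M.Δ X| := fun X => by
    rw [abs_mul, abs_mul]
    exact mul_le_mul_of_nonneg_right
      (mul_le_of_le_one_right (abs_nonneg _) (M.abs_spin_le σ X)) (abs_nonneg _)
  have h2 : ∀ X, ∀ x : ℝ, |x| ≤ 1 → |M.β * M.spin σ X * M.Δ X * x| ≤ |M.β| * |M.Δ X| :=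
    fun X x hx => by
      rw [abs_mul]; exact (mul_le_of_le_one_right (abs_nonneg _) hx).trans (h1 X)
  rcases k with X | X <;> simp only [coeff, Sum.elim_inl, Sum.elim_inr] <;> split_ifs
  · exact h2 X _ (Real.abs_cos_le_one t)
  · exact h1 X
  · exact h2 X _ (Real.abs_sin_le_one t)
  · rw [abs_zero]; positivity

lemma memLp_press (μ t : ℝ) : MemLp (M.press μ t) 2 (stdNormal (ι ⊕ ι)) :=
  memLp_two_of_linear_growth
    (continuous_of_coord_lipschitz (M.abs_press_sub_le μ t)).aestronglyMeasurable
    (linear_growth_of_coord_lipschitz M.lipschitz_coeff_nonneg (M.abs_press_sub_le μ t))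

/-- The pressure is Lipschitz in each Gaussian variable with constant `|β| |Δ_X|`. The factor `2`
counts the two copies of every coupling. -/
lemma variance_press_le (μ t : ℝ) :
    Var[M.press μ t; stdNormal (ι ⊕ ι)] ≤ 2 * M.β ^ 2 * M.totalVar := by
  refine (variance_le_sum_sq M.lipschitz_coeff_nonneg (M.abs_press_sub_le μ t)).trans
    (le_of_eq ?_)
  rw [Fintype.sum_sum_type]
  simp only [Sum.elim_inl, Sum.elim_inr, mul_pow, sq_abs, ← Finset.mul_sum, totalVar]
  ring

lemma memLp_magIn (μ t : ℝ) : MemLp (M.magIn μ t) 2 (stdNormal (ι ⊕ ι)) :=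
  MemLp.of_bound ((M.continuous_magIn.comp (f := fun g => (μ, t, g))
    (by fun_prop)).aestronglyMeasurable) M.totalMean (ae_of_all _ (M.abs_magIn_le μ t))

/-- The variance of the magnetization conjugate to `μ`. -/
def varMagIn (μ t : ℝ) : ℝ := Var[M.magIn μ t; stdNormal (ι ⊕ ι)]

lemma varMagIn_le (μ t : ℝ) : M.varMagIn μ t ≤ M.totalMean ^ 2 := by
  refine (variance_le_expectation_sq (M.memLp_magIn μ t).aestronglyMeasurable).trans ?_
  refine (integral_mono_of_nonneg (g := fun _ => M.totalMean ^ 2) (ae_of_all _ fun g => sq_nonneg _)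
    (integrable_const _) (ae_of_all _ fun g => ?_)).trans (by simp)
  exact sq_le_sq' (abs_le.1 (M.abs_magIn_le μ t g)).1 (abs_le.1 (M.abs_magIn_le μ t g)).2

lemma continuous_integral_magIn :
    Continuous fun p : ℝ × ℝ => ∫ g, M.magIn p.1 p.2 g ∂stdNormal (ι ⊕ ι) := by
  refine continuous_integral_stdNormal (f := fun (p : ℝ × ℝ) g => M.magIn p.1 p.2 g)
    (C := M.totalMean) ?_ fun p g => ?_
  · exact M.continuous_magIn.comp (f := fun q : (ℝ × ℝ) × (ι ⊕ ι → ℝ) => (q.1.1, q.1.2, q.2))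
      (by fun_prop)
  · refine (M.abs_magIn_le _ _ _).trans (le_mul_of_one_le_right M.totalMean_nonneg ?_)
    nlinarith [norm_nonneg g]

lemma continuous_varMagIn : Continuous fun p : ℝ × ℝ => M.varMagIn p.1 p.2 := by
  have h : ∀ p : ℝ × ℝ, M.varMagIn p.1 p.2 = (∫ g, M.magIn p.1 p.2 g ^ 2 ∂stdNormal (ι ⊕ ι))
      - (∫ g, M.magIn p.1 p.2 g ∂stdNormal (ι ⊕ ι)) ^ 2 := fun p =>
    variance_eq_sub (M.memLp_magIn p.1 p.2)
  simp_rw [h]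
  refine Continuous.sub ?_ (M.continuous_integral_magIn.pow 2)
  refine continuous_integral_stdNormal (f := fun (p : ℝ × ℝ) g => M.magIn p.1 p.2 g ^ 2)
    (C := M.totalMean ^ 2) ?_ fun p g => ?_
  · exact (M.continuous_magIn.comp (f := fun q : (ℝ × ℝ) × (ι ⊕ ι → ℝ) => (q.1.1, q.1.2, q.2))
      (by fun_prop)).pow 2
  · rw [abs_pow]
    refine (pow_le_pow_left₀ (abs_nonneg _) (M.abs_magIn_le _ _ _) 2).trans
      (le_mul_of_one_le_right (sq_nonneg _) ?_)
    nlinarith [norm_nonneg g]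

lemma press_add_ge (μ δ t : ℝ) (g : ι ⊕ ι → ℝ) :
    M.press μ t g + δ * (M.β * (Real.cos t + Real.sin t)) * M.magIn μ t g
      ≤ M.press (μ + δ) t g := by
  have := logPart_add_ge (M.logw μ t g)
    fun σ => δ * (M.β * (Real.cos t + Real.sin t)) * M.meanIn σ
  rwa [gibbs_const_mul, ← logw_add] at this

/-- The derivative of the pressure in `μ` fluctuates little if the pressure does and if the
derivative does not vary much. -/
lemma mul_varMagIn_le (μ t : ℝ) {δ : ℝ} (hδ : 0 < δ) :
    (M.β * (Real.cos t + Real.sin t)) ^ 2 * M.varMagIn μ t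
      ≤ 16 * M.β ^ 2 * M.totalVar / δ ^ 2 + 8 * |M.β| * M.totalMean *
        (M.β * (Real.cos t + Real.sin t)) *
        ((∫ g, M.magIn (μ + δ) t g ∂stdNormal (ι ⊕ ι)) - ∫ g, M.magIn μ t g ∂stdNormal (ι ⊕ ι)) := by
  set b := M.β * (Real.cos t + Real.sin t) with hb
  have hbL : |b| ≤ 2 * |M.β| := by
    rw [hb, abs_mul, mul_comm]
    exact mul_le_mul_of_nonneg_right (abs_cos_add_sin_le t) (abs_nonneg _)
  have hq : MemLp (fun g => b * M.magIn μ t g) 2 (stdNormal (ι ⊕ ι)) :=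
    (M.memLp_magIn μ t).const_mul b
  have hd : MemLp (fun g => δ⁻¹ * (M.press (μ + δ) t g - M.press μ t g)) 2 (stdNormal (ι ⊕ ι)) :=
    ((M.memLp_press (μ + δ) t).sub (M.memLp_press μ t)).const_mul δ⁻¹
  have h := variance_le_add_integral_sq hq hd
  rw [variance_const_mul, variance_const_mul] at h
  have hv := variance_sub_le (M.memLp_press (μ + δ) t) (M.memLp_press μ t)
  have h1 := M.variance_press_le (μ + δ) t
  have h2 := M.variance_press_le μ t
  have hi : Integrable (fun g => M.magIn (μ + δ) t g - M.magIn μ t g) (stdNormal (ι ⊕ ι)) :=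
    ((M.memLp_magIn (μ + δ) t).integrable one_le_two).sub
      ((M.memLp_magIn μ t).integrable one_le_two)
  have hsq : ∫ g, (b * M.magIn μ t g - δ⁻¹ * (M.press (μ + δ) t g - M.press μ t g)) ^ 2
      ∂stdNormal (ι ⊕ ι) ≤ ∫ g, 4 * |M.β| * M.totalMean * b *
        (M.magIn (μ + δ) t g - M.magIn μ t g) ∂stdNormal (ι ⊕ ι) := by
    refine integral_mono_of_nonneg (ae_of_all _ fun g => sq_nonneg _) (hi.const_mul _)
      (ae_of_all _ fun g => ?_)
    -- The tangents at `μ` and at `μ + δ` enclose the difference quotient of the pressure: its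
    -- excess `y` over the derivative at `μ` is nonnegative and at most the increment of the
    -- derivative.
    have t1 := M.press_add_ge μ δ t g
    have t2 := M.press_add_ge (μ + δ) (-δ) t g
    rw [add_neg_cancel_right] at t2
    rw [← hb] at t1 t2
    have l1 : 0 ≤ δ⁻¹ * (M.press (μ + δ) t g - M.press μ t g) - b * M.magIn μ t g := by
      rw [sub_nonneg, inv_mul_eq_div, le_div_iff₀ hδ]; linarith
    have l2 : δ⁻¹ * (M.press (μ + δ) t g - M.press μ t g) ≤ b * M.magIn (μ + δ) t g := by
      rw [inv_mul_eq_div, div_le_iff₀ hδ]; linarith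
    have l3 : b * (M.magIn (μ + δ) t g - M.magIn μ t g) ≤ 4 * |M.β| * M.totalMean := by
      refine (le_abs_self _).trans ?_
      rw [abs_mul]
      have := (abs_sub (M.magIn (μ + δ) t g) (M.magIn μ t g)).trans
        (add_le_add (M.abs_magIn_le _ _ _) (M.abs_magIn_le _ _ _))
      calc _ ≤ (2 * |M.β|) * (M.totalMean + M.totalMean) :=
            mul_le_mul hbL this (abs_nonneg _) (by positivity)
        _ = _ := by ring
    set y := δ⁻¹ * (M.press (μ + δ) t g - M.press μ t g) - b * M.magIn μ t g
    have l4 : y ≤ b * (M.magIn (μ + δ) t g - M.magIn μ t g) := by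
      simp only [y]; linarith
    have e : (b * M.magIn μ t g - δ⁻¹ * (M.press (μ + δ) t g - M.press μ t g)) ^ 2 = y * y := by
      simp only [y]; ring
    beta_reduce
    rw [e, mul_assoc (4 * |M.β| * M.totalMean)]
    -- Only one factor `y` is replaced by a constant; the other is kept as an increment of the
    -- derivative, whose integral over `μ` reduces to boundary terms.
    exact mul_le_mul (l4.trans l3) l4 l1 (l1.trans (l4.trans l3))
  rw [integral_const_mul, integral_sub ((M.memLp_magIn (μ + δ) t).integrable one_le_two)
      ((M.memLp_magIn μ t).integrable one_le_two)] at hsq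
  have h3 : δ⁻¹ ^ 2 * Var[fun g => M.press (μ + δ) t g - M.press μ t g; stdNormal (ι ⊕ ι)]
      ≤ δ⁻¹ ^ 2 * (8 * M.β ^ 2 * M.totalVar) :=
    mul_le_mul_of_nonneg_left (by linarith) (sq_nonneg _)
  -- Each pressure has variance at most `2 β² totalVar`; the difference of two costs `8 β²
  -- totalVar`, and the comparison of derivative and quotient doubles this.
  have e2 : 16 * M.β ^ 2 * M.totalVar / δ ^ 2 = 2 * (δ⁻¹ ^ 2 * (8 * M.β ^ 2 * M.totalVar)) := by
    rw [inv_pow]; ring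
  rw [e2]
  unfold varMagIn
  linarith

/-- Averaged over `μ`, the magnetization conjugate to `μ` has small fluctuations. -/
lemma integral_varMagIn_le {μ₁ μ₂ : ℝ} (hμ : μ₁ ≤ μ₂) (hβ : 0 < M.β) (t : ℝ) {δ : ℝ}
    (hδ : 0 < δ) :
    (Real.cos t + Real.sin t) ^ 2 * ∫ μ in μ₁..μ₂, M.varMagIn μ t
      ≤ 16 * M.totalVar * (μ₂ - μ₁) / δ ^ 2 + 32 * M.totalMean ^ 2 * δ := by
  set b := M.β * (Real.cos t + Real.sin t) with hb
  set q : ℝ → ℝ := fun μ => ∫ g, M.magIn μ t g ∂stdNormal (ι ⊕ ι) with hq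
  have hqc : Continuous q := M.continuous_integral_magIn.comp (f := fun μ => (μ, t)) (by fun_prop)
  have hqb : ∀ μ, |q μ| ≤ M.totalMean := fun μ => by
    have := norm_integral_le_of_norm_le_const (μ := stdNormal (ι ⊕ ι))
      (f := M.magIn μ t) (ae_of_all _ (M.abs_magIn_le μ t))
    simpa using this
  have hvc : Continuous fun μ => M.varMagIn μ t :=
    M.continuous_varMagIn.comp (f := fun μ => (μ, t)) (by fun_prop)
  have hqi : ∀ a b : ℝ, IntervalIntegrable q volume a b := fun a b => hqc.intervalIntegrable a b
  have hmain : b ^ 2 * ∫ μ in μ₁..μ₂, M.varMagIn μ t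
      ≤ (μ₂ - μ₁) * (16 * M.β ^ 2 * M.totalVar / δ ^ 2)
        + 8 * |M.β| * M.totalMean * b * ∫ μ in μ₁..μ₂, (q (μ + δ) - q μ) := by
    rw [← intervalIntegral.integral_const_mul, ← intervalIntegral.integral_const_mul,
      ← smul_eq_mul (μ₂ - μ₁), ← intervalIntegral.integral_const, ← intervalIntegral.integral_add]
    · refine intervalIntegral.integral_mono_on hμ ?_ ?_ fun μ _ => M.mul_varMagIn_le μ t hδ
      · exact (hvc.const_mul _).intervalIntegrable _ _
      · exact Continuous.intervalIntegrable (by fun_prop) _ _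
    · exact Continuous.intervalIntegrable (by fun_prop) _ _
    · exact Continuous.intervalIntegrable (by fun_prop) _ _
  have hshift : |∫ μ in μ₁..μ₂, (q (μ + δ) - q μ)| ≤ 2 * M.totalMean * δ := by
    rw [intervalIntegral.integral_sub (Continuous.intervalIntegrable (by fun_prop) _ _) (hqi _ _),
      intervalIntegral.integral_comp_add_right]
    -- The overlapping parts of the interval and its shift cancel, leaving two end intervals of
    -- length `δ`. No regularity of `q` in `μ` beyond boundedness enters the estimate.
    have e : (∫ μ in (μ₁ + δ)..(μ₂ + δ), q μ) - ∫ μ in μ₁..μ₂, q μ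
        = (∫ μ in μ₂..(μ₂ + δ), q μ) - ∫ μ in μ₁..(μ₁ + δ), q μ := by
      have h1 := intervalIntegral.integral_add_adjacent_intervals (hqi μ₁ (μ₁ + δ))
        (hqi (μ₁ + δ) (μ₂ + δ))
      have h2 := intervalIntegral.integral_add_adjacent_intervals (hqi μ₁ μ₂) (hqi μ₂ (μ₂ + δ))
      linarith
    rw [e]
    have h1 := abs_intervalIntegral_le hqb (le_add_of_nonneg_right hδ.le : μ₂ ≤ μ₂ + δ)
    have h2 := abs_intervalIntegral_le hqb (le_add_of_nonneg_right hδ.le : μ₁ ≤ μ₁ + δ)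
    rw [add_sub_cancel_left] at h1 h2
    refine (abs_sub _ _).trans ?_
    linarith
  have hbL : |b| ≤ 2 * |M.β| := by
    rw [hb, abs_mul, mul_comm]
    exact mul_le_mul_of_nonneg_right (abs_cos_add_sin_le t) (abs_nonneg _)
  have hT := M.totalMean_nonneg
  have hlast : 8 * |M.β| * M.totalMean * b * ∫ μ in μ₁..μ₂, (q (μ + δ) - q μ)
      ≤ 32 * M.β ^ 2 * M.totalMean ^ 2 * δ := by
    refine (le_abs_self _).trans ?_
    rw [abs_mul, abs_mul, abs_of_nonneg (by positivity : 0 ≤ 8 * |M.β| * M.totalMean)]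
    calc _ ≤ 8 * |M.β| * M.totalMean * (2 * |M.β|) * (2 * M.totalMean * δ) := by gcongr
      _ = 32 * |M.β| ^ 2 * M.totalMean ^ 2 * δ := by ring
      _ = _ := by rw [sq_abs]
  have hβ2 : 0 < M.β ^ 2 := by positivity
  refine le_of_mul_le_mul_left ?_ hβ2
  calc M.β ^ 2 * ((Real.cos t + Real.sin t) ^ 2 * ∫ μ in μ₁..μ₂, M.varMagIn μ t)
      = b ^ 2 * ∫ μ in μ₁..μ₂, M.varMagIn μ t := by rw [hb]; ring
    _ ≤ _ := hmain
    _ ≤ (μ₂ - μ₁) * (16 * M.β ^ 2 * M.totalVar / δ ^ 2)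
        + 32 * M.β ^ 2 * M.totalMean ^ 2 * δ := by linarith
    _ = _ := by ring

end Model

end RotatedModel

/-! ### The flow, its variance, and the bound on the replicon. -/

lemma abs_cos_sub_sin_le (t : ℝ) : |Real.cos t - Real.sin t| ≤ 2 :=
  (abs_sub _ _).trans (by linarith [Real.abs_cos_le_one t, Real.abs_sin_le_one t])

namespace RotatedModel

section Model

variable {S ι : Type*} [Fintype ι] [DecidableEq ι] (M : RotatedModel S ι)

lemma coeff_dotProduct (t : ℝ) (σ : S) (g : ι ⊕ ι → ℝ) : M.coeff t σ ⬝ᵥ g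
    = M.β * ((∑ X ∈ M.inner, M.spin σ X * M.Δ X *
        (Real.cos t * g (Sum.inl X) + Real.sin t * g (Sum.inr X)))
      + ∑ X ∈ M.innerᶜ, M.spin σ X * M.Δ X * g (Sum.inl X)) := by
  have h1 : ∑ X, M.coeff t σ (Sum.inl X) * g (Sum.inl X)
      = (∑ X ∈ M.inner, M.β * M.spin σ X * M.Δ X * Real.cos t * g (Sum.inl X))
        + ∑ X ∈ M.innerᶜ, M.β * M.spin σ X * M.Δ X * g (Sum.inl X) := by
    rw [← Finset.sum_add_sum_compl M.inner]
    congr 1 <;> refine Finset.sum_congr rfl fun X hX => ?_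
    · simp [coeff, hX]
    · simp [coeff, Finset.mem_compl.1 hX]
  have h2 : ∑ X, M.coeff t σ (Sum.inr X) * g (Sum.inr X)
      = ∑ X ∈ M.inner, M.β * M.spin σ X * M.Δ X * Real.sin t * g (Sum.inr X) := by
    rw [← Finset.sum_add_sum_compl M.inner]
    have h0 : ∑ X ∈ M.innerᶜ, M.coeff t σ (Sum.inr X) * g (Sum.inr X) = 0 :=
      Finset.sum_eq_zero fun X hX => by simp [coeff, Finset.mem_compl.1 hX]
    rw [h0, add_zero]
    refine Finset.sum_congr rfl fun X hX => ?_
    simp [coeff, hX]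
  rw [dotProduct, Fintype.sum_sum_type, h1, h2, mul_add, Finset.mul_sum, Finset.mul_sum,
    add_right_comm, ← Finset.sum_add_distrib]
  congr 1 <;> refine Finset.sum_congr rfl fun X _ => ?_ <;> ring

lemma hasDerivAt_logw (μ t : ℝ) (g : ι ⊕ ι → ℝ) (σ : S) :
    HasDerivAt (fun t => M.logw μ t g σ)
      (M.β * ((Real.cos t - Real.sin t) * μ * M.meanIn σ
        + ∑ X ∈ M.inner, (M.dir t X ⬝ᵥ g) * M.spin σ X)) t := by
  have h1 : HasDerivAt (fun t => M.drift μ t σ)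
      (M.β * ((-Real.sin t + Real.cos t) * μ * M.meanIn σ)) t :=
    (((((Real.hasDerivAt_cos t).add (Real.hasDerivAt_sin t)).mul_const μ).mul_const
      (M.meanIn σ)).add_const _).const_mul M.β
  have h2 : HasDerivAt (fun t => M.coeff t σ ⬝ᵥ g)
      (M.β * ∑ X ∈ M.inner, M.spin σ X * M.Δ X *
        (-Real.sin t * g (Sum.inl X) + Real.cos t * g (Sum.inr X))) t := by
    simp_rw [coeff_dotProduct]
    exact ((HasDerivAt.fun_sum fun X _ => (((Real.hasDerivAt_cos t).mul_const _).add
      ((Real.hasDerivAt_sin t).mul_const _)).const_mul _).add_const _).const_mul M.β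
  refine (h1.add h2).congr_deriv ?_
  rw [← mul_add]
  congr 2
  · ring
  · refine Finset.sum_congr rfl fun X _ => ?_
    rw [dir_dotProduct]; ring

variable [Fintype S] [Nonempty S]

/-- The fundamental theorem of calculus, with the derivative of the exponent split into the motion
of the means and that of the centred Gaussian parts. -/
lemma press_pi_sub_press_zero (μ : ℝ) (g : ι ⊕ ι → ℝ) :
    M.press μ Real.pi g - M.press μ 0 g
      = ∫ t in (0 : ℝ)..Real.pi, M.β * ((Real.cos t - Real.sin t) * μ * M.magIn μ t g
        + M.speed μ t g) := by
  symm
  refine intervalIntegral.integral_eq_sub_of_hasDerivAt (f := fun t => M.press μ t g)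
    (fun t _ => ?_) ?_
  · refine (hasDerivAt_logPart (M.hasDerivAt_logw μ t g)).congr_deriv ?_
    rw [gibbs_const_mul, gibbs_add, gibbs_const_mul, gibbs_sum]
    simp_rw [gibbs_const_mul]
    rfl
  · have h1 : Continuous fun t => M.magIn μ t g :=
      M.continuous_magIn.comp (f := fun t => (μ, t, g)) (by fun_prop)
    have h2 : Continuous fun t => M.speed μ t g :=
      M.continuous_speed.comp (f := fun t => (μ, t, g)) (by fun_prop)
    exact Continuous.intervalIntegrable (by fun_prop) _ _

/-- The contribution of the centred couplings to the change of the pressure. -/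
def flow (μ : ℝ) (g : ι ⊕ ι → ℝ) : ℝ := ∫ t in (0 : ℝ)..Real.pi, M.speed μ t g

/-- The contribution of the means to the change of the pressure. -/
def meanFlow (μ : ℝ) (g : ι ⊕ ι → ℝ) : ℝ :=
  ∫ t in (0 : ℝ)..Real.pi, (Real.cos t - Real.sin t) * μ * M.magIn μ t g

lemma continuous_speed_uncurry (μ : ℝ) :
    Continuous (Function.uncurry fun (t : ℝ) (g : ι ⊕ ι → ℝ) => M.speed μ t g) :=
  M.continuous_speed.comp (f := fun p : ℝ × (ι ⊕ ι → ℝ) => (μ, p.1, p.2)) (by fun_prop)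

lemma continuous_magIn_uncurry (μ : ℝ) :
    Continuous (Function.uncurry fun (t : ℝ) (g : ι ⊕ ι → ℝ) => M.magIn μ t g) :=
  M.continuous_magIn.comp (f := fun p : ℝ × (ι ⊕ ι → ℝ) => (μ, p.1, p.2)) (by fun_prop)

lemma continuous_flow (μ : ℝ) : Continuous (M.flow μ) :=
  continuous_intervalIntegral (M.continuous_speed_uncurry μ) _ _

lemma continuous_meanFlow_integrand (μ : ℝ) : Continuous (Function.uncurry
    fun (t : ℝ) (g : ι ⊕ ι → ℝ) => (Real.cos t - Real.sin t) * μ * M.magIn μ t g) := by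
  have := M.continuous_magIn_uncurry μ
  exact Continuous.mul (by fun_prop) this

lemma continuous_meanFlow (μ : ℝ) : Continuous (M.meanFlow μ) :=
  continuous_intervalIntegral (M.continuous_meanFlow_integrand μ) _ _

lemma abs_flow_le (μ : ℝ) (g : ι ⊕ ι → ℝ) :
    |M.flow μ g| ≤ (∑ X ∈ M.inner, 2 * |M.Δ X|) * Real.pi * (1 + ‖g‖) := by
  have := abs_intervalIntegral_le (fun t => M.abs_speed_le μ t g) Real.pi_pos.le
  rw [sub_zero] at this
  refine this.trans (le_of_eq ?_)
  ring

lemma abs_meanFlow_integrand_le (μ t : ℝ) (g : ι ⊕ ι → ℝ) :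
    |(Real.cos t - Real.sin t) * μ * M.magIn μ t g| ≤ 2 * |μ| * M.totalMean := by
  rw [abs_mul, abs_mul]
  exact mul_le_mul (mul_le_mul_of_nonneg_right (abs_cos_sub_sin_le t) (abs_nonneg _))
    (M.abs_magIn_le μ t g) (abs_nonneg _) (by positivity)

lemma memLp_meanFlow (μ : ℝ) : MemLp (M.meanFlow μ) 2 (stdNormal (ι ⊕ ι)) :=
  MemLp.of_bound (M.continuous_meanFlow μ).aestronglyMeasurable _ (ae_of_all _ fun g =>
    abs_intervalIntegral_le (fun t => M.abs_meanFlow_integrand_le μ t g) Real.pi_pos.le)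

/-- This form bounds the variance of the flow without any knowledge of the replicon: it involves
only two pressures and `meanFlow`. -/
lemma flow_eq (hβ : M.β ≠ 0) (μ : ℝ) (g : ι ⊕ ι → ℝ) :
    M.flow μ g = M.β⁻¹ * (M.press μ Real.pi g - M.press μ 0 g) - M.meanFlow μ g := by
  rw [press_pi_sub_press_zero, intervalIntegral.integral_const_mul, inv_mul_cancel_left₀ hβ,
    intervalIntegral.integral_add, flow, meanFlow, add_sub_cancel_left]
  · exact ((M.continuous_meanFlow_integrand μ).uncurry_right g).intervalIntegrable _ _
  · exact ((M.continuous_speed_uncurry μ).uncurry_right g).intervalIntegrable _ _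

lemma integral_flow (μ : ℝ) : ∫ g, M.flow μ g ∂stdNormal (ι ⊕ ι) = 0 := by
  unfold flow
  rw [integral_intervalIntegral_swap (M.continuous_speed_uncurry μ)
    (C := ∑ X ∈ M.inner, 2 * |M.Δ X|)]
  · simp [integral_speed]
  · intro t g
    refine (M.abs_speed_le μ t g).trans ?_
    have := norm_nonneg g
    gcongr
    nlinarith

lemma continuous_overlap :
    Continuous fun p : ℝ × ℝ × ℝ => M.overlap p.1 p.2.1 p.2.2 := by
  refine continuous_integral_stdNormal (f := fun (p : ℝ × ℝ × ℝ) g => ∑ X ∈ M.inner,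
    M.Δ X ^ 2 * (M.mag p.1 p.2.1 g X * M.mag p.1 p.2.2 g X)) (C := ∑ X ∈ M.inner, M.Δ X ^ 2) ?_
    fun p g => ?_
  · refine continuous_finsetSum _ fun X _ => continuous_const.mul (Continuous.mul ?_ ?_)
    · exact (M.continuous_mag X).comp
        (f := fun q : (ℝ × ℝ × ℝ) × (ι ⊕ ι → ℝ) => (q.1.1, q.1.2.1, q.2)) (by fun_prop)
    · exact (M.continuous_mag X).comp
        (f := fun q : (ℝ × ℝ × ℝ) × (ι ⊕ ι → ℝ) => (q.1.1, q.1.2.2, q.2)) (by fun_prop)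
  · refine le_trans ?_ (le_mul_of_one_le_right (by positivity)
      (by nlinarith [norm_nonneg g] : 1 ≤ (1 + ‖g‖) ^ 2))
    refine (Finset.abs_sum_le_sum_abs _ _).trans (Finset.sum_le_sum fun X _ => ?_)
    rw [abs_mul, abs_mul, abs_sq]
    exact mul_le_of_le_one_right (sq_nonneg _)
      (mul_le_one₀ (M.abs_mag_le _ _ _ _) (abs_nonneg _) (M.abs_mag_le _ _ _ _))

lemma abs_overlap_le (μ t s : ℝ) : |M.overlap μ t s| ≤ M.totalVar := by
  have : ∀ g, ‖∑ X ∈ M.inner, M.Δ X ^ 2 * (M.mag μ t g X * M.mag μ s g X)‖ ≤ M.totalVar := by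
    intro g
    refine (norm_sum_le _ _).trans ((Finset.sum_le_sum fun X _ => ?_).trans
      (Finset.sum_le_univ_sum_of_nonneg fun X => sq_nonneg (M.Δ X)))
    rw [Real.norm_eq_abs, abs_mul, abs_mul, abs_sq]
    exact mul_le_of_le_one_right (sq_nonneg _)
      (mul_le_one₀ (M.abs_mag_le _ _ _ _) (abs_nonneg _) (M.abs_mag_le _ _ _ _))
  have := norm_integral_le_of_norm_le_const (μ := stdNormal (ι ⊕ ι)) (ae_of_all _ this)
  rw [probReal_univ, mul_one] at this
  exact this

lemma continuous_replicon :
    Continuous fun p : ℝ × ℝ × ℝ => M.replicon p.1 p.2.1 p.2.2 := by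
  refine continuous_integral_stdNormal (f := fun (p : ℝ × ℝ × ℝ) g => ∑ X ∈ M.inner,
    ∑ Y ∈ M.inner, M.Δ X ^ 2 * M.Δ Y ^ 2 * (M.corr p.1 p.2.1 g X Y * M.corr p.1 p.2.2 g X Y))
    (C := ∑ X ∈ M.inner, ∑ Y ∈ M.inner, M.Δ X ^ 2 * M.Δ Y ^ 2 * (2 * 2)) ?_ fun p g => ?_
  · refine continuous_finsetSum _ fun X _ => continuous_finsetSum _ fun Y _ =>
      continuous_const.mul (Continuous.mul ?_ ?_)
    · exact (M.continuous_corr X Y).comp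
        (f := fun q : (ℝ × ℝ × ℝ) × (ι ⊕ ι → ℝ) => (q.1.1, q.1.2.1, q.2)) (by fun_prop)
    · exact (M.continuous_corr X Y).comp
        (f := fun q : (ℝ × ℝ × ℝ) × (ι ⊕ ι → ℝ) => (q.1.1, q.1.2.2, q.2)) (by fun_prop)
  · refine le_trans ?_ (le_mul_of_one_le_right (by positivity)
      (by nlinarith [norm_nonneg g] : 1 ≤ (1 + ‖g‖) ^ 2))
    refine (Finset.abs_sum_le_sum_abs _ _).trans (Finset.sum_le_sum fun X _ => ?_)
    refine (Finset.abs_sum_le_sum_abs _ _).trans (Finset.sum_le_sum fun Y _ => ?_)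
    rw [abs_mul, abs_mul (M.corr _ _ _ _ _),
      abs_of_nonneg (by positivity : 0 ≤ M.Δ X ^ 2 * M.Δ Y ^ 2)]
    exact mul_le_mul_of_nonneg_left (mul_le_mul (M.abs_corr_le _ _ _ _ _) (M.abs_corr_le _ _ _ _ _)
      (abs_nonneg _) zero_le_two) (by positivity)

lemma integral_flow_sq_eq_integral_speed_mul_speed (μ : ℝ) :
    ∫ g, M.flow μ g ^ 2 ∂stdNormal (ι ⊕ ι)
      = ∫ t in (0 : ℝ)..Real.pi, ∫ s in (0 : ℝ)..Real.pi,
          ∫ g, M.speed μ t g * M.speed μ s g ∂stdNormal (ι ⊕ ι) := by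
  set C := ∑ X ∈ M.inner, 2 * |M.Δ X| with hC
  have hC0 : 0 ≤ C := by positivity
  have hsp := M.continuous_speed_uncurry μ
  have h1 : ∀ g, M.flow μ g ^ 2 = ∫ t in (0 : ℝ)..Real.pi, M.speed μ t g * M.flow μ g := by
    intro g
    rw [intervalIntegral.integral_mul_const, sq]
    exact congrArg (· * M.flow μ g) (flow.eq_1 M μ g)
  have h2 : ∀ t g, M.speed μ t g * M.flow μ g
      = ∫ s in (0 : ℝ)..Real.pi, M.speed μ t g * M.speed μ s g := by
    intro t g
    rw [intervalIntegral.integral_const_mul]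
    exact congrArg (M.speed μ t g * ·) (flow.eq_1 M μ g)
  have h3 : Continuous fun p : ℝ × (ι ⊕ ι → ℝ) => M.speed μ p.1 p.2 * M.flow μ p.2 :=
    Continuous.mul hsp ((M.continuous_flow μ).comp continuous_snd)
  simp_rw [h1]
  rw [integral_intervalIntegral_swap (f := fun t g => M.speed μ t g * M.flow μ g) h3
    (C := C * (C * Real.pi))]
  · refine intervalIntegral.integral_congr fun t _ => ?_
    have h4 : Continuous fun p : ℝ × (ι ⊕ ι → ℝ) => M.speed μ t p.2 * M.speed μ p.1 p.2 :=
      Continuous.mul (hsp.comp (f := fun p : ℝ × (ι ⊕ ι → ℝ) => (t, p.2)) (by fun_prop)) hsp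
    simp_rw [h2]
    refine integral_intervalIntegral_swap (f := fun s g => M.speed μ t g * M.speed μ s g) h4
      (C := C * C) (fun s g => ?_) _ _
    rw [abs_mul]
    calc _ ≤ (C * (1 + ‖g‖)) * (C * (1 + ‖g‖)) :=
          mul_le_mul (M.abs_speed_le μ t g) (M.abs_speed_le μ s g) (abs_nonneg _) (by positivity)
      _ = _ := by ring
  · intro t g
    rw [abs_mul]
    calc _ ≤ (C * (1 + ‖g‖)) * (C * Real.pi * (1 + ‖g‖)) :=
          mul_le_mul (M.abs_speed_le μ t g) (M.abs_flow_le μ g) (abs_nonneg _) (by positivity)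
      _ = _ := by ring

lemma integral_flow_sq (μ : ℝ) :
    ∫ g, M.flow μ g ^ 2 ∂stdNormal (ι ⊕ ι)
      = (∫ t in (0 : ℝ)..Real.pi, ∫ s in (0 : ℝ)..Real.pi,
          Real.cos (t - s) * M.overlap μ t s)
        - M.β ^ 2 * ∫ t in (0 : ℝ)..Real.pi, ∫ s in (0 : ℝ)..Real.pi,
          Real.sin (t - s) ^ 2 * M.replicon μ t s := by
  have hcO' : Continuous fun p : ℝ × ℝ => Real.cos (p.2 - p.1) * M.overlap μ p.2 p.1 :=
    Continuous.mul (by fun_prop)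
      (M.continuous_overlap.comp (f := fun p : ℝ × ℝ => (μ, p.2, p.1)) (by fun_prop))
  have hcR' : Continuous fun p : ℝ × ℝ => Real.sin (p.2 - p.1) ^ 2 * M.replicon μ p.2 p.1 :=
    Continuous.mul (by fun_prop)
      (M.continuous_replicon.comp (f := fun p : ℝ × ℝ => (μ, p.2, p.1)) (by fun_prop))
  have hOint : Continuous fun t => ∫ s in (0 : ℝ)..Real.pi, Real.cos (t - s) * M.overlap μ t s :=
    continuous_intervalIntegral (f := fun s t => Real.cos (t - s) * M.overlap μ t s)
      hcO' _ _
  have hRint : Continuous fun t => ∫ s in (0 : ℝ)..Real.pi,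
      Real.sin (t - s) ^ 2 * M.replicon μ t s :=
    continuous_intervalIntegral (f := fun s t => Real.sin (t - s) ^ 2 * M.replicon μ t s)
      hcR' _ _
  have inner : ∀ t, ∫ s in (0 : ℝ)..Real.pi, (Real.cos (t - s) * M.overlap μ t s
        - M.β ^ 2 * (Real.sin (t - s) ^ 2 * M.replicon μ t s))
      = (∫ s in (0 : ℝ)..Real.pi, Real.cos (t - s) * M.overlap μ t s)
        - M.β ^ 2 * ∫ s in (0 : ℝ)..Real.pi, Real.sin (t - s) ^ 2 * M.replicon μ t s := by
    intro t
    have c1 : Continuous fun s => Real.cos (t - s) * M.overlap μ t s :=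
      Continuous.mul (by fun_prop)
        (M.continuous_overlap.comp (f := fun s => (μ, t, s)) (by fun_prop))
    have c2 : Continuous fun s => Real.sin (t - s) ^ 2 * M.replicon μ t s :=
      Continuous.mul (by fun_prop)
        (M.continuous_replicon.comp (f := fun s => (μ, t, s)) (by fun_prop))
    rw [intervalIntegral.integral_sub (c1.intervalIntegrable _ _)
      ((c2.const_mul (M.β ^ 2)).intervalIntegrable _ _), intervalIntegral.integral_const_mul]
  rw [integral_flow_sq_eq_integral_speed_mul_speed]
  simp_rw [integral_speed_mul_speed, inner]
  rw [intervalIntegral.integral_sub (hOint.intervalIntegrable _ _)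
    ((hRint.const_mul (M.β ^ 2)).intervalIntegrable _ _), intervalIntegral.integral_const_mul]

/-- Cauchy–Schwarz in `t` applied to the centred integrand. The constant combines the length `π` of
the interval with `(cos t - sin t)² ≤ 4`. -/
lemma variance_meanFlow_le (μ : ℝ) :
    Var[M.meanFlow μ; stdNormal (ι ⊕ ι)]
      ≤ 4 * Real.pi * μ ^ 2 * ∫ t in (0 : ℝ)..Real.pi, M.varMagIn μ t := by
  set q : ℝ → ℝ := fun t => ∫ g, M.magIn μ t g ∂stdNormal (ι ⊕ ι) with hq
  have hqc : Continuous q := M.continuous_integral_magIn.comp (f := fun t => (μ, t)) (by fun_prop)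
  have hmc := M.continuous_magIn_uncurry μ
  have hqb : ∀ t, |q t| ≤ M.totalMean := fun t => by
    have := norm_integral_le_of_norm_le_const (μ := stdNormal (ι ⊕ ι))
      (f := M.magIn μ t) (ae_of_all _ (M.abs_magIn_le μ t))
    simpa using this
  have hT := M.totalMean_nonneg
  have hmean : ∫ g, M.meanFlow μ g ∂stdNormal (ι ⊕ ι)
      = ∫ t in (0 : ℝ)..Real.pi, (Real.cos t - Real.sin t) * μ * q t := by
    unfold meanFlow
    rw [integral_intervalIntegral_swap (M.continuous_meanFlow_integrand μ)
      (C := 2 * |μ| * M.totalMean)]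
    · simp_rw [integral_const_mul, hq]
    · intro t g
      refine (M.abs_meanFlow_integrand_le μ t g).trans
        (le_mul_of_one_le_right (by positivity) ?_)
      nlinarith [norm_nonneg g]
  have hF : Continuous (Function.uncurry fun (t : ℝ) (g : ι ⊕ ι → ℝ) =>
      (M.magIn μ t g - q t) ^ 2) :=
    (hmc.sub (hqc.comp continuous_fst)).pow 2
  have hpt : ∀ g, (M.meanFlow μ g - ∫ g, M.meanFlow μ g ∂stdNormal (ι ⊕ ι)) ^ 2
      ≤ 4 * Real.pi * μ ^ 2 * ∫ t in (0 : ℝ)..Real.pi, (M.magIn μ t g - q t) ^ 2 := by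
    intro g
    have hm : Continuous fun t => M.magIn μ t g := hmc.uncurry_right g
    have e : M.meanFlow μ g - ∫ g, M.meanFlow μ g ∂stdNormal (ι ⊕ ι)
        = ∫ t in (0 : ℝ)..Real.pi, (Real.cos t - Real.sin t) * μ * (M.magIn μ t g - q t) := by
      rw [hmean, meanFlow, ← intervalIntegral.integral_sub]
      · simp_rw [mul_sub]
      · exact Continuous.intervalIntegrable (by fun_prop) _ _
      · exact Continuous.intervalIntegrable (by fun_prop) _ _
    rw [e]
    refine (sq_intervalIntegral_le (by fun_prop) Real.pi_pos.le).trans ?_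
    have hle : ∫ t in (0 : ℝ)..Real.pi, ((Real.cos t - Real.sin t) * μ * (M.magIn μ t g - q t)) ^ 2
        ≤ ∫ t in (0 : ℝ)..Real.pi, 4 * μ ^ 2 * (M.magIn μ t g - q t) ^ 2 := by
      refine intervalIntegral.integral_mono_on Real.pi_pos.le
        (Continuous.intervalIntegrable (by fun_prop) _ _)
        (Continuous.intervalIntegrable (by fun_prop) _ _) fun t _ => ?_
      have h4 : (Real.cos t - Real.sin t) ^ 2 ≤ 4 := by
        have := pow_le_pow_left₀ (abs_nonneg _) (abs_cos_sub_sin_le t) 2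
        rw [sq_abs] at this
        linarith
      rw [mul_pow, mul_pow]
      gcongr
    rw [intervalIntegral.integral_const_mul] at hle
    calc _ ≤ Real.pi * (4 * μ ^ 2 * ∫ t in (0 : ℝ)..Real.pi, (M.magIn μ t g - q t) ^ 2) := by
          rw [sub_zero]; exact mul_le_mul_of_nonneg_left hle Real.pi_pos.le
      _ = _ := by ring
  have hFb : ∀ t g, |(M.magIn μ t g - q t) ^ 2| ≤ (2 * M.totalMean) ^ 2 := fun t g => by
    rw [abs_pow]
    refine pow_le_pow_left₀ (abs_nonneg _) ?_ 2
    have := (abs_sub (M.magIn μ t g) (q t)).trans (add_le_add (M.abs_magIn_le μ t g) (hqb t))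
    linarith
  have hswap := integral_intervalIntegral_swap hF (C := (2 * M.totalMean) ^ 2) (fun t g =>
    (hFb t g).trans (le_mul_of_one_le_right (by positivity) (by nlinarith [norm_nonneg g])))
    0 Real.pi
  have hvar : ∀ t, ∫ g, (M.magIn μ t g - q t) ^ 2 ∂stdNormal (ι ⊕ ι) = M.varMagIn μ t := fun t =>
    (variance_eq_integral (M.memLp_magIn μ t).aestronglyMeasurable.aemeasurable).symm
  simp_rw [hvar] at hswap
  rw [variance_eq_integral (M.continuous_meanFlow μ).aemeasurable, ← hswap, ← integral_const_mul]
  refine integral_mono_of_nonneg (ae_of_all _ fun g => sq_nonneg _) ?_ (ae_of_all _ hpt)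
  refine Integrable.const_mul (Integrable.of_bound
    (continuous_intervalIntegral hF _ _).aestronglyMeasurable _ (ae_of_all _ fun g =>
      abs_intervalIntegral_le (fun t => hFb t g) Real.pi_pos.le)) _

/-- The double integral of the replicon is controlled by the fluctuations of the magnetization
conjugate to `μ`. -/
lemma sq_mul_abs_integral_replicon_le (hβ : 0 < M.β) (μ : ℝ) :
    M.β ^ 2 * |∫ t in (0 : ℝ)..Real.pi, ∫ s in (0 : ℝ)..Real.pi,
        Real.sin (t - s) ^ 2 * M.replicon μ t s|
      ≤ (Real.pi ^ 2 + 16) * M.totalVar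
        + 8 * Real.pi * μ ^ 2 * ∫ t in (0 : ℝ)..Real.pi, M.varMagIn μ t := by
  have h0 : 0 ≤ ∫ g, M.flow μ g ^ 2 ∂stdNormal (ι ⊕ ι) := integral_nonneg fun _ => sq_nonneg _
  have hvar : ∫ g, M.flow μ g ^ 2 ∂stdNormal (ι ⊕ ι) = Var[M.flow μ; stdNormal (ι ⊕ ι)] :=
    (variance_of_integral_eq_zero (M.continuous_flow μ).aemeasurable (M.integral_flow μ)).symm
  have hP : MemLp (fun g => M.β⁻¹ * (M.press μ Real.pi g - M.press μ 0 g)) 2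
      (stdNormal (ι ⊕ ι)) :=
    ((M.memLp_press μ Real.pi).sub (M.memLp_press μ 0)).const_mul M.β⁻¹
  have h1 := variance_sub_le hP (M.memLp_meanFlow μ)
  have e : (fun g => M.β⁻¹ * (M.press μ Real.pi g - M.press μ 0 g) - M.meanFlow μ g) = M.flow μ :=
    funext fun g => (M.flow_eq hβ.ne' μ g).symm
  rw [e, variance_const_mul] at h1
  have h2 := variance_sub_le (M.memLp_press μ Real.pi) (M.memLp_press μ 0)
  have h3 := M.variance_press_le μ Real.pi
  have h4 := M.variance_press_le μ 0
  have h5 : M.β⁻¹ ^ 2 * Var[fun g => M.press μ Real.pi g - M.press μ 0 g; stdNormal (ι ⊕ ι)]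
      ≤ 8 * M.totalVar := by
    calc _ ≤ M.β⁻¹ ^ 2 * (8 * M.β ^ 2 * M.totalVar) :=
          mul_le_mul_of_nonneg_left (by linarith) (sq_nonneg _)
      _ = _ := by field_simp
  have h6 := M.variance_meanFlow_le μ
  have h7 : |∫ t in (0 : ℝ)..Real.pi, ∫ s in (0 : ℝ)..Real.pi,
      Real.cos (t - s) * M.overlap μ t s| ≤ Real.pi ^ 2 * M.totalVar := by
    have hin : ∀ t, |∫ s in (0 : ℝ)..Real.pi, Real.cos (t - s) * M.overlap μ t s|
        ≤ M.totalVar * Real.pi := fun t => by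
      have := abs_intervalIntegral_le (f := fun s => Real.cos (t - s) * M.overlap μ t s)
        (C := M.totalVar) (fun s => by
          rw [abs_mul]
          exact (mul_le_of_le_one_left (abs_nonneg _) (Real.abs_cos_le_one _)).trans
            (M.abs_overlap_le μ t s)) Real.pi_pos.le
      rwa [sub_zero] at this
    have := abs_intervalIntegral_le hin Real.pi_pos.le
    rw [sub_zero] at this
    linarith
  have h8 := M.integral_flow_sq μ
  set R := ∫ t in (0 : ℝ)..Real.pi, ∫ s in (0 : ℝ)..Real.pi,
    Real.sin (t - s) ^ 2 * M.replicon μ t s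
  have h9 : M.β ^ 2 * |R| = |M.β ^ 2 * R| := by rw [abs_mul, abs_sq]
  have hK := M.totalVar_nonneg
  have h10 := abs_le.1 h7
  -- `β² R` equals the overlap integral minus the variance of the flow. The overlap contributes `π²
  -- totalVar`; the endpoint pressures contribute twice `8 totalVar`, and `meanFlow` twice its
  -- variance bound.
  rw [h9, abs_le]
  constructor <;> linarith

end Model

end RotatedModel

/-! ### Expansion of the replicon into moments of the overlaps. -/

lemma intervalIntegral_swap_of_continuous {f : ℝ → ℝ → ℝ} (hf : Continuous (Function.uncurry f))
    (a b c d : ℝ) : ∫ x in a..b, ∫ y in c..d, f x y = ∫ y in c..d, ∫ x in a..b, f x y := by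
  refine intervalIntegral_intervalIntegral_swap ?_
  refine (hf.continuousOn.integrableOn_compact
    ((isCompact_uIcc (a := a) (b := b)).prod (isCompact_uIcc (a := c) (b := d)))).mono_set ?_
  exact Set.prod_mono Set.uIoc_subset_uIcc Set.uIoc_subset_uIcc

lemma integral_sub_sub_add {Ω : Type*} [MeasurableSpace Ω] {P : Measure Ω} {A B C D : Ω → ℝ}
    (hA : Integrable A P) (hB : Integrable B P) (hC : Integrable C P) (hD : Integrable D P) :
    ∫ ω, (A ω - B ω - C ω + D ω) ∂P = ∫ ω, A ω ∂P - ∫ ω, B ω ∂P - ∫ ω, C ω ∂P + ∫ ω, D ω ∂P := by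
  have h1 : Integrable (fun ω => A ω - B ω) P := hA.sub hB
  have h2 : Integrable (fun ω => A ω - B ω - C ω) P := h1.sub hC
  rw [integral_add h2 hD, integral_sub h1 hC, integral_sub hA hB]

lemma abs_mul_le_one {x y : ℝ} (hx : |x| ≤ 1) (hy : |y| ≤ 1) : |x * y| ≤ 1 := by
  rw [abs_mul]; exact mul_le_one₀ hx (abs_nonneg _) hy

namespace RotatedModel

section PairSum

variable {S ι : Type*} [Fintype ι] (M : RotatedModel S ι)

/-- The covariance-weighted mean of a function of two couplings. -/
def pairSum (F : (ι ⊕ ι → ℝ) → ι → ι → ℝ) : ℝ :=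
  ∫ g, ∑ X ∈ M.inner, ∑ Y ∈ M.inner, M.Δ X ^ 2 * M.Δ Y ^ 2 * F g X Y ∂stdNormal (ι ⊕ ι)

lemma integrable_pairSum {F : (ι ⊕ ι → ℝ) → ι → ι → ℝ}
    (hF : ∀ X Y, Continuous fun g => F g X Y) (hb : ∀ g X Y, |F g X Y| ≤ 1) :
    Integrable (fun g => ∑ X ∈ M.inner, ∑ Y ∈ M.inner, M.Δ X ^ 2 * M.Δ Y ^ 2 * F g X Y)
      (stdNormal (ι ⊕ ι)) :=
  integrable_finsetSum _ fun X _ => integrable_finsetSum _ fun Y _ =>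
    (Integrable.of_bound (hF X Y).aestronglyMeasurable 1
      (ae_of_all _ fun g => hb g X Y)).const_mul _

end PairSum

section Model

variable {S ι : Type*} [Fintype S] [Nonempty S] [Fintype ι] [DecidableEq ι] (M : RotatedModel S ι)

/-- The Gibbs average of the product of two spin products. -/
def pairMag (μ t : ℝ) (g : ι ⊕ ι → ℝ) (X Y : ι) : ℝ :=
  gibbs (M.logw μ t g) fun σ => M.spin σ X * M.spin σ Y

lemma continuous_pairMag (X Y : ι) :
    Continuous fun p : ℝ × ℝ × (ι ⊕ ι → ℝ) => M.pairMag p.1 p.2.1 p.2.2 X Y :=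
  M.continuous_gibbs_logw _

lemma abs_pairMag_le (μ t : ℝ) (g : ι ⊕ ι → ℝ) (X Y : ι) : |M.pairMag μ t g X Y| ≤ 1 :=
  abs_gibbs_le _ fun σ => by
    rw [abs_mul]; exact mul_le_one₀ (M.abs_spin_le σ X) (abs_nonneg _) (M.abs_spin_le σ Y)

/-- The mixed term of the replicon. -/
def mixed (μ t s : ℝ) : ℝ :=
  M.pairSum fun g X Y => M.mag μ s g X * M.pairMag μ t g X Y * M.mag μ s g Y

lemma continuous_mixed : Continuous fun p : ℝ × ℝ × ℝ => M.mixed p.1 p.2.1 p.2.2 := by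
  refine continuous_integral_stdNormal (f := fun (p : ℝ × ℝ × ℝ) g => ∑ X ∈ M.inner,
    ∑ Y ∈ M.inner, M.Δ X ^ 2 * M.Δ Y ^ 2 *
      (M.mag p.1 p.2.2 g X * M.pairMag p.1 p.2.1 g X Y * M.mag p.1 p.2.2 g Y))
    (C := ∑ X ∈ M.inner, ∑ Y ∈ M.inner, M.Δ X ^ 2 * M.Δ Y ^ 2) ?_ fun p g => ?_
  · have h : ∀ X, Continuous fun q : (ℝ × ℝ × ℝ) × (ι ⊕ ι → ℝ) => M.mag q.1.1 q.1.2.2 q.2 X :=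
      fun X => (M.continuous_mag X).comp
        (f := fun q : (ℝ × ℝ × ℝ) × (ι ⊕ ι → ℝ) => (q.1.1, q.1.2.2, q.2)) (by fun_prop)
    have h' : ∀ X Y, Continuous fun q : (ℝ × ℝ × ℝ) × (ι ⊕ ι → ℝ) =>
        M.pairMag q.1.1 q.1.2.1 q.2 X Y :=
      fun X Y => (M.continuous_pairMag X Y).comp
        (f := fun q : (ℝ × ℝ × ℝ) × (ι ⊕ ι → ℝ) => (q.1.1, q.1.2.1, q.2)) (by fun_prop)
    exact continuous_finsetSum _ fun X _ => continuous_finsetSum _ fun Y _ =>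
      continuous_const.mul (((h X).mul (h' X Y)).mul (h Y))
  · refine le_trans ?_ (le_mul_of_one_le_right (by positivity)
      (by nlinarith [norm_nonneg g] : 1 ≤ (1 + ‖g‖) ^ 2))
    refine (Finset.abs_sum_le_sum_abs _ _).trans (Finset.sum_le_sum fun X _ => ?_)
    refine (Finset.abs_sum_le_sum_abs _ _).trans (Finset.sum_le_sum fun Y _ => ?_)
    rw [abs_mul, abs_of_nonneg (by positivity : 0 ≤ M.Δ X ^ 2 * M.Δ Y ^ 2)]
    exact mul_le_of_le_one_right (by positivity) (abs_mul_le_one (abs_mul_le_one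
      (M.abs_mag_le _ _ _ _) (M.abs_pairMag_le _ _ _ _ _)) (M.abs_mag_le _ _ _ _))

/-- Multiplying out the two truncated correlations gives one mixed term with the pair correlation at
`t` and one with it at `s`. Counting the former twice instead produces the antisymmetric correction.
-/
lemma pairSum_sub_add_eq (μ t s : ℝ) :
    M.pairSum (fun g X Y => M.pairMag μ t g X Y * M.pairMag μ s g X Y)
      - 2 * M.mixed μ t s
      + M.pairSum (fun g X Y => M.mag μ t g X * M.mag μ s g X * (M.mag μ s g Y * M.mag μ t g Y))
    = M.replicon μ t s + (M.mixed μ s t - M.mixed μ t s) := by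
  have cm : ∀ t X, Continuous fun g => M.mag μ t g X := fun t X =>
    (M.continuous_mag X).comp (f := fun g => (μ, t, g)) (by fun_prop)
  have cp : ∀ t X Y, Continuous fun g => M.pairMag μ t g X Y := fun t X Y =>
    (M.continuous_pairMag X Y).comp (f := fun g => (μ, t, g)) (by fun_prop)
  have i1 := M.integrable_pairSum (F := fun g X Y => M.pairMag μ t g X Y * M.pairMag μ s g X Y)
    (fun X Y => (cp t X Y).mul (cp s X Y))
    fun g X Y => abs_mul_le_one (M.abs_pairMag_le _ _ _ _ _) (M.abs_pairMag_le _ _ _ _ _)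
  have i2 : ∀ t s, Integrable (fun g => ∑ X ∈ M.inner, ∑ Y ∈ M.inner, M.Δ X ^ 2 * M.Δ Y ^ 2 *
      (M.mag μ s g X * M.pairMag μ t g X Y * M.mag μ s g Y)) (stdNormal (ι ⊕ ι)) := fun t s =>
    M.integrable_pairSum
      (F := fun g X Y => M.mag μ s g X * M.pairMag μ t g X Y * M.mag μ s g Y)
      (fun X Y => ((cm s X).mul (cp t X Y)).mul (cm s Y))
      fun g X Y => abs_mul_le_one (abs_mul_le_one (M.abs_mag_le _ _ _ _)
        (M.abs_pairMag_le _ _ _ _ _)) (M.abs_mag_le _ _ _ _)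
  have i3 := M.integrable_pairSum
    (F := fun g X Y => M.mag μ t g X * M.mag μ s g X * (M.mag μ s g Y * M.mag μ t g Y))
    (fun X Y => ((cm t X).mul (cm s X)).mul ((cm s Y).mul (cm t Y)))
    fun g X Y => abs_mul_le_one (abs_mul_le_one (M.abs_mag_le _ _ _ _) (M.abs_mag_le _ _ _ _))
      (abs_mul_le_one (M.abs_mag_le _ _ _ _) (M.abs_mag_le _ _ _ _))
  have key : M.replicon μ t s
      = M.pairSum (fun g X Y => M.pairMag μ t g X Y * M.pairMag μ s g X Y)
        - M.mixed μ t s - M.mixed μ s t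
        + M.pairSum (fun g X Y =>
          M.mag μ t g X * M.mag μ s g X * (M.mag μ s g Y * M.mag μ t g Y)) := by
    unfold replicon mixed pairSum
    rw [← integral_sub_sub_add i1 (i2 t s) (i2 s t) i3]
    refine integral_congr_ae (ae_of_all _ fun g => ?_)
    simp only [← Finset.sum_sub_distrib, ← Finset.sum_add_distrib]
    refine Finset.sum_congr rfl fun X _ => Finset.sum_congr rfl fun Y _ => ?_
    have e : ∀ t, M.corr μ t g X Y = M.pairMag μ t g X Y - M.mag μ t g X * M.mag μ t g Y :=
      fun t => rfl
    rw [e, e]; ring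
  rw [key]; ring

/-- Exchange the order of integration and the names of the variables; `sin² (t - s)` is symmetric.
-/
lemma integral_sin_sq_mul_mixed (μ : ℝ) :
    ∫ t in (0 : ℝ)..Real.pi, ∫ s in (0 : ℝ)..Real.pi, Real.sin (t - s) ^ 2 * M.mixed μ s t
      = ∫ t in (0 : ℝ)..Real.pi, ∫ s in (0 : ℝ)..Real.pi, Real.sin (t - s) ^ 2 * M.mixed μ t s := by
  have h : Continuous (Function.uncurry fun t s : ℝ => Real.sin (t - s) ^ 2 * M.mixed μ s t) :=
    Continuous.mul (by fun_prop)
      (M.continuous_mixed.comp (f := fun p : ℝ × ℝ => (μ, p.2, p.1)) (by fun_prop))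
  rw [intervalIntegral_swap_of_continuous h]
  have e : ∀ t s : ℝ, Real.sin (s - t) ^ 2 = Real.sin (t - s) ^ 2 := fun t s => by
    rw [← neg_sub, Real.sin_neg, neg_sq]
  refine intervalIntegral.integral_congr fun t _ => intervalIntegral.integral_congr fun s _ => ?_
  simp only [e t s]

lemma integral_sin_sq_mul_symm (μ : ℝ) :
    ∫ t in (0 : ℝ)..Real.pi, ∫ s in (0 : ℝ)..Real.pi,
        Real.sin (t - s) ^ 2 * (M.replicon μ t s + (M.mixed μ s t - M.mixed μ t s))
      = ∫ t in (0 : ℝ)..Real.pi, ∫ s in (0 : ℝ)..Real.pi,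
        Real.sin (t - s) ^ 2 * M.replicon μ t s := by
  have ii : ∀ F : ℝ → ℝ → ℝ, Continuous (Function.uncurry F) →
      Continuous fun t => ∫ s in (0 : ℝ)..Real.pi, F t s := fun F hF => by
    have hF' : Continuous fun p : ℝ × ℝ => F p.2 p.1 :=
      hF.comp (f := fun p : ℝ × ℝ => (p.2, p.1)) (by fun_prop)
    exact continuous_intervalIntegral (f := fun s t => F t s) hF' _ _
  have c1 : Continuous (Function.uncurry fun t s : ℝ => Real.sin (t - s) ^ 2 * M.replicon μ t s) :=
    Continuous.mul (by fun_prop)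
      (M.continuous_replicon.comp (f := fun p : ℝ × ℝ => (μ, p.1, p.2)) (by fun_prop))
  have c2 : Continuous (Function.uncurry fun t s : ℝ => Real.sin (t - s) ^ 2 * M.mixed μ s t) :=
    Continuous.mul (by fun_prop)
      (M.continuous_mixed.comp (f := fun p : ℝ × ℝ => (μ, p.2, p.1)) (by fun_prop))
  have c3 : Continuous (Function.uncurry fun t s : ℝ => Real.sin (t - s) ^ 2 * M.mixed μ t s) :=
    Continuous.mul (by fun_prop)
      (M.continuous_mixed.comp (f := fun p : ℝ × ℝ => (μ, p.1, p.2)) (by fun_prop))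
  have inner : ∀ t : ℝ, ∫ s in (0 : ℝ)..Real.pi,
        Real.sin (t - s) ^ 2 * (M.replicon μ t s + (M.mixed μ s t - M.mixed μ t s))
      = (∫ s in (0 : ℝ)..Real.pi, Real.sin (t - s) ^ 2 * M.replicon μ t s)
        + ((∫ s in (0 : ℝ)..Real.pi, Real.sin (t - s) ^ 2 * M.mixed μ s t)
        - ∫ s in (0 : ℝ)..Real.pi, Real.sin (t - s) ^ 2 * M.mixed μ t s) := by
    intro t
    have d1 := (c1.uncurry_left t).intervalIntegrable (μ := volume) 0 Real.pi
    have d2 := (c2.uncurry_left t).intervalIntegrable (μ := volume) 0 Real.pi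
    have d3 := (c3.uncurry_left t).intervalIntegrable (μ := volume) 0 Real.pi
    rw [← intervalIntegral.integral_sub d2 d3, ← intervalIntegral.integral_add d1 (d2.sub d3)]
    refine intervalIntegral.integral_congr fun s _ => ?_
    simp only [mul_add, mul_sub]
  simp_rw [inner]
  have d1 := (ii _ c1).intervalIntegrable (μ := volume) 0 Real.pi
  have d2 := (ii _ c2).intervalIntegrable (μ := volume) 0 Real.pi
  have d3 := (ii _ c3).intervalIntegrable (μ := volume) 0 Real.pi
  rw [intervalIntegral.integral_add d1 (d2.sub d3), intervalIntegral.integral_sub d2 d3,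
    integral_sin_sq_mul_mixed, sub_self, add_zero]

lemma sq_mul_abs_integral_integral_replicon_le (hβ : 0 < M.β) {μ₁ μ₂ : ℝ} (hμ : μ₁ ≤ μ₂) :
    M.β ^ 2 * |∫ μ in μ₁..μ₂, ∫ t in (0 : ℝ)..Real.pi, ∫ s in (0 : ℝ)..Real.pi,
        Real.sin (t - s) ^ 2 * M.replicon μ t s|
      ≤ (Real.pi ^ 2 + 16) * (μ₂ - μ₁) * M.totalVar
        + 8 * Real.pi * (μ₁ ^ 2 + μ₂ ^ 2) *
          ∫ t in (0 : ℝ)..Real.pi, ∫ μ in μ₁..μ₂, M.varMagIn μ t := by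
  have hβ2 : 0 < M.β ^ 2 := by positivity
  have hv : Continuous (Function.uncurry fun μ t : ℝ => M.varMagIn μ t) := M.continuous_varMagIn
  have hv' : Continuous fun p : ℝ × ℝ => M.varMagIn p.2 p.1 :=
    M.continuous_varMagIn.comp (f := fun p : ℝ × ℝ => (p.2, p.1)) (by fun_prop)
  have hvc : Continuous fun μ => ∫ t in (0 : ℝ)..Real.pi, M.varMagIn μ t :=
    continuous_intervalIntegral (f := fun t μ => M.varMagIn μ t) hv' _ _
  have hbound : |∫ μ in μ₁..μ₂, ∫ t in (0 : ℝ)..Real.pi, ∫ s in (0 : ℝ)..Real.pi,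
        Real.sin (t - s) ^ 2 * M.replicon μ t s|
      ≤ ∫ μ in μ₁..μ₂, (M.β ^ 2)⁻¹ * ((Real.pi ^ 2 + 16) * M.totalVar
        + 8 * Real.pi * (μ₁ ^ 2 + μ₂ ^ 2) * ∫ t in (0 : ℝ)..Real.pi, M.varMagIn μ t) := by
    have hbc : Continuous fun μ => (M.β ^ 2)⁻¹ * ((Real.pi ^ 2 + 16) * M.totalVar
        + 8 * Real.pi * (μ₁ ^ 2 + μ₂ ^ 2) * ∫ t in (0 : ℝ)..Real.pi, M.varMagIn μ t) :=
      (continuous_const.add (hvc.const_mul (8 * Real.pi * (μ₁ ^ 2 + μ₂ ^ 2)))).const_mul _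
    rw [← Real.norm_eq_abs]
    refine intervalIntegral.norm_integral_le_of_norm_le hμ (ae_of_all _ fun μ hμI => ?_)
      (hbc.intervalIntegrable _ _)
    rw [Real.norm_eq_abs, le_inv_mul_iff₀ hβ2]
    refine (M.sq_mul_abs_integral_replicon_le hβ μ).trans ?_
    have h0 : 0 ≤ ∫ t in (0 : ℝ)..Real.pi, M.varMagIn μ t :=
      intervalIntegral.integral_nonneg Real.pi_pos.le fun t _ => variance_nonneg _ _
    -- On the interval, `μ²` is at most the larger endpoint square; the sum avoids distinguishing
    -- the signs of the endpoints.
    have h1 : μ ^ 2 ≤ μ₁ ^ 2 + μ₂ ^ 2 := by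
      rcases le_total 0 μ with h | h <;> nlinarith [hμI.1, hμI.2, sq_nonneg μ₁, sq_nonneg μ₂]
    have hpi := Real.pi_pos
    gcongr
  rw [intervalIntegral.integral_const_mul, le_inv_mul_iff₀ hβ2] at hbound
  refine hbound.trans (le_of_eq ?_)
  rw [intervalIntegral.integral_add (continuous_const.intervalIntegrable _ _)
    ((hvc.const_mul (8 * Real.pi * (μ₁ ^ 2 + μ₂ ^ 2))).intervalIntegrable _ _), intervalIntegral.integral_const,
    intervalIntegral.integral_const_mul, intervalIntegral_swap_of_continuous hv, smul_eq_mul]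
  ring

end Model

end RotatedModel

/-! ### Realization of the lattice system as a rotated model. -/

section Lattice

variable {d : ℕ} (β : ℝ) (Δ m m' : Finset (Site d) → ℝ) (Λ Λ' : Finset (Site d))

lemma abs_spinProd_le {Λ : Finset (Site d)} (σ : Config Λ) (X : Finset (Site d)) :
    |spinProd σ X| ≤ 1 := by
  unfold spinProd
  split_ifs
  · simp
  · rw [Finset.abs_prod]
    refine Finset.prod_le_one (fun _ _ => abs_nonneg _) fun i _ => ?_
    split_ifs
    · rcases Int.units_eq_one_or (σ i) with h | h <;> simp [h]
    · simp

/-- The interpolated spin system in `Λ` as a rotated model. -/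
def latticeModel : RotatedModel (Config Λ) ↥Λ.powerset where
  β := β
  spin σ X := spinProd σ X
  inner := Finset.univ.filter fun X => (X : Finset (Site d)) ⊆ Λ'
  Δ X := Δ X
  m X := m X
  m' X := m' X
  abs_spin_le σ X := abs_spinProd_le σ X

/-- The couplings as functions of standard Gaussian variables. -/
def couplings (μ : ℝ) (g : ↥Λ.powerset ⊕ ↥Λ.powerset → ℝ) : Couplings Λ × Couplings Λ :=
  (fun X => paramMean m m' Λ' μ X + Δ X * g (Sum.inl X),
    fun X => paramMean m m' Λ' μ X + Δ X * g (Sum.inr X))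

instance isProbabilityMeasure_gaussianReal_mk (a v : ℝ) (hv : 0 ≤ v) :
    IsProbabilityMeasure (gaussianReal a ⟨v, hv⟩) :=
  instIsProbabilityMeasureGaussianReal a ⟨v, hv⟩

lemma measurePreserving_affine (a b : ℝ) :
    MeasurePreserving (fun x => a + b * x) (gaussianReal 0 1)
      (gaussianReal a ⟨b ^ 2, sq_nonneg _⟩) := by
  refine ⟨by fun_prop, ?_⟩
  have : (fun x : ℝ => a + b * x) = (fun x => a + x) ∘ fun x => b * x := rfl
  rw [this, ← Measure.map_map (by fun_prop) (by fun_prop), gaussianReal_map_const_mul,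
    gaussianReal_map_const_add, mul_zero, zero_add, mul_one]
  rfl

/-- Quenched averages thereby become integrals over one standard Gaussian vector. `J` and its copy
occupy the two summands of the index type. -/
lemma measurePreserving_couplings (μ : ℝ) :
    MeasurePreserving (couplings Δ m m' Λ Λ' μ) (stdNormal (↥Λ.powerset ⊕ ↥Λ.powerset))
      (disorderLaw Λ (paramMean m m' Λ' μ) Δ) := by
  have h1 := measurePreserving_sumPiEquivProdPi (ι := ↥Λ.powerset) (ι' := ↥Λ.powerset)
    (X := fun _ => ℝ) fun _ => gaussianReal 0 1
  have h2 : MeasurePreserving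
      (fun (g : ↥Λ.powerset → ℝ) (X : ↥Λ.powerset) => paramMean m m' Λ' μ X + Δ X * g X)
      (Measure.pi fun _ => gaussianReal 0 1) (couplingLaw Λ (paramMean m m' Λ' μ) Δ) :=
    measurePreserving_pi _ _ fun X => measurePreserving_affine _ _
  have : SigmaFinite (couplingLaw Λ (paramMean m m' Λ' μ) Δ) := by
    unfold couplingLaw; infer_instance
  exact (h2.prod h2).comp h1

lemma neg_mul_interpHam (μ t : ℝ) (g : ↥Λ.powerset ⊕ ↥Λ.powerset → ℝ) (σ : Config Λ) :
    -β * interpHam Λ' t (couplings Δ m m' Λ Λ' μ g) σ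
      = (latticeModel β Δ m m' Λ Λ').logw μ t g σ := by
  have hin : ∀ J : Couplings Λ, hamIn Λ' J σ
      = -∑ X ∈ (latticeModel β Δ m m' Λ Λ').inner, J X * spinProd σ X := fun J => by
    simp only [hamIn, latticeModel, Finset.sum_filter]
  have hout : ∀ J : Couplings Λ, hamOut Λ' J σ
      = -∑ X ∈ (latticeModel β Δ m m' Λ Λ').innerᶜ, J X * spinProd σ X := fun J => by
    simp only [hamOut, latticeModel, Finset.compl_filter, Finset.sum_filter, ite_not]
  have e1 : ∀ X ∈ (latticeModel β Δ m m' Λ Λ').inner, paramMean m m' Λ' μ X = μ * m' X :=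
    fun X hX => if_pos (Finset.mem_filter.1 hX).2
  have e2 : ∀ X ∈ (latticeModel β Δ m m' Λ Λ').innerᶜ, paramMean m m' Λ' μ X = m X := by
    intro X hX
    refine if_neg fun h => Finset.mem_compl.1 hX ?_
    exact Finset.mem_filter.2 ⟨Finset.mem_univ _, h⟩
  rw [RotatedModel.logw, RotatedModel.coeff_dotProduct, RotatedModel.drift, RotatedModel.meanIn,
    interpHam, hin, hin, hout, ← mul_add]
  -- The copy has the same means as `J`, so the rotated means add up to `(cos t + sin t) μ m'`. They
  -- are not rotated isometrically like the centred parts, whence the factor in `drift`.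
  have s1 : ∀ k : ↥Λ.powerset → ℝ, ∑ X ∈ (latticeModel β Δ m m' Λ Λ').inner,
      (paramMean m m' Λ' μ X + Δ X * k X) * spinProd σ X
      = μ * (∑ X ∈ (latticeModel β Δ m m' Λ Λ').inner, m' X * spinProd σ X)
        + ∑ X ∈ (latticeModel β Δ m m' Λ Λ').inner, spinProd σ X * Δ X * k X := fun k => by
    rw [Finset.mul_sum, ← Finset.sum_add_distrib]
    refine Finset.sum_congr rfl fun X hX => ?_
    rw [e1 X hX]; ring
  have s2 : ∀ k : ↥Λ.powerset → ℝ, ∑ X ∈ (latticeModel β Δ m m' Λ Λ').innerᶜ,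
      (paramMean m m' Λ' μ X + Δ X * k X) * spinProd σ X
      = (∑ X ∈ (latticeModel β Δ m m' Λ Λ').innerᶜ, m X * spinProd σ X)
        + ∑ X ∈ (latticeModel β Δ m m' Λ Λ').innerᶜ, spinProd σ X * Δ X * k X := fun k => by
    rw [← Finset.sum_add_distrib]
    refine Finset.sum_congr rfl fun X hX => ?_
    rw [e2 X hX]; ring
  have s3 : ∑ X ∈ (latticeModel β Δ m m' Λ Λ').inner, spinProd σ X * Δ X *
      (Real.cos t * g (Sum.inl X) + Real.sin t * g (Sum.inr X))
      = Real.cos t * (∑ X ∈ (latticeModel β Δ m m' Λ Λ').inner,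
          spinProd σ X * Δ X * g (Sum.inl X))
        + Real.sin t * ∑ X ∈ (latticeModel β Δ m m' Λ Λ').inner,
          spinProd σ X * Δ X * g (Sum.inr X) := by
    rw [Finset.mul_sum, Finset.mul_sum, ← Finset.sum_add_distrib]
    exact Finset.sum_congr rfl fun X _ => by ring
  simp only [couplings]
  rw [s1 fun X => g (Sum.inl X), s1 fun X => g (Sum.inr X), s2 fun X => g (Sum.inl X)]
  change _ = β * (_ * μ * (∑ X ∈ (latticeModel β Δ m m' Λ Λ').inner, m' X * spinProd σ X) +
    (∑ X ∈ (latticeModel β Δ m m' Λ Λ').innerᶜ, m X * spinProd σ X) +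
    ((∑ X ∈ (latticeModel β Δ m m' Λ Λ').inner, spinProd σ X * Δ X *
      (Real.cos t * g (Sum.inl X) + Real.sin t * g (Sum.inr X))) +
      ∑ X ∈ (latticeModel β Δ m m' Λ Λ').innerᶜ, spinProd σ X * Δ X * g (Sum.inl X)))
  rw [s3]
  ring

/-- The replicas are independent given the disorder: the sum over all configurations of a product
factorizes. -/
lemma randomState_prod {Λ : Finset (Site d)} {n : ℕ} (t : Fin n → ℝ)
    (ω : Couplings Λ × Couplings Λ) (φ : Fin n → Config Λ → ℝ) :
    randomState β Λ' t ω (fun σ => ∏ k, φ k (σ k))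
      = ∏ k, gibbs (fun σ => -β * interpHam Λ' (t k) ω σ) (φ k) := by
  unfold randomState gibbs partitionFn
  simp_rw [← Finset.prod_mul_distrib]
  have h := Finset.prod_univ_sum (fun _ : Fin n => (Finset.univ : Finset (Config Λ)))
    fun k σ => φ k σ * Real.exp (-β * interpHam Λ' (t k) ω σ)
  rw [Fintype.piFinset_univ] at h
  rw [← h, ← Finset.prod_mul_distrib]
  refine Finset.prod_congr rfl fun k _ => ?_
  rw [inv_mul_eq_div]

lemma randomState_sum {Λ : Finset (Site d)} {n : ℕ} (t : Fin n → ℝ)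
    (ω : Couplings Λ × Couplings Λ) {α : Type*} (s : Finset α) (c : α → ℝ)
    (f : α → (Fin n → Config Λ) → ℝ) :
    randomState β Λ' t ω (fun σ => ∑ a ∈ s, c a * f a σ)
      = ∑ a ∈ s, c a * randomState β Λ' t ω (f a) := by
  unfold randomState
  simp_rw [Finset.sum_mul, Finset.mul_sum]
  rw [Finset.sum_comm]
  refine Finset.sum_congr rfl fun a _ => Finset.sum_congr rfl fun σ _ => ?_
  ring

lemma continuous_randomState {Λ : Finset (Site d)} {n : ℕ} (t : Fin n → ℝ)
    (f : (Fin n → Config Λ) → ℝ) :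
    Continuous fun ω : Couplings Λ × Couplings Λ => randomState β Λ' t ω f := by
  have hI : ∀ J : Couplings Λ × Couplings Λ → Couplings Λ, Continuous J → ∀ σ : Config Λ,
      Continuous fun ω => hamIn Λ' (J ω) σ := fun J hJ σ => by
    unfold hamIn
    refine (continuous_finsetSum _ fun X _ => ?_).neg
    split_ifs <;> fun_prop
  have hO : ∀ σ : Config Λ,
      Continuous fun ω : Couplings Λ × Couplings Λ => hamOut Λ' ω.1 σ := fun σ => by
    unfold hamOut
    refine (continuous_finsetSum _ fun X _ => ?_).neg
    split_ifs <;> fun_prop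
  have hH : ∀ t (σ : Config Λ),
      Continuous fun ω : Couplings Λ × Couplings Λ => interpHam Λ' t ω σ := fun t σ =>
    (((hI _ continuous_fst σ).const_mul _).add ((hI _ continuous_snd σ).const_mul _)).add (hO σ)
  unfold randomState
  refine Continuous.mul (continuous_finsetProd _ fun k _ => Continuous.inv₀ ?_ fun ω => ?_) ?_
  · exact continuous_finsetSum _ fun σ _ => ((hH _ σ).const_mul _).rexp
  · exact (sum_exp_pos fun σ => -β * interpHam Λ' (t k) ω σ).ne'
  · exact continuous_finsetSum _ fun σ _ => continuous_const.mul
      (continuous_finsetProd _ fun k _ => ((hH _ _).const_mul _).rexp)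

lemma quenched_eq (μ : ℝ) {n : ℕ} (t : Fin n → ℝ) (f : (Fin n → Config Λ) → ℝ) :
    quenched β Δ m m' Λ Λ' μ t f
      = ∫ g, randomState β Λ' t (couplings Δ m m' Λ Λ' μ g) f
        ∂stdNormal (↥Λ.powerset ⊕ ↥Λ.powerset) := by
  have mp := measurePreserving_couplings Δ m m' Λ Λ' μ
  unfold quenched
  rw [← mp.map_eq, integral_map mp.measurable.aemeasurable
    (continuous_randomState β Λ' t f).aestronglyMeasurable]

/-- The quenched average of a covariance-weighted sum of products over the replicas. -/
lemma quenched_pairSum (μ : ℝ) {n : ℕ} (t : Fin n → ℝ) (c : ℝ)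
    (φ : ↥Λ.powerset → ↥Λ.powerset → Fin n → Config Λ → ℝ) :
    quenched β Δ m m' Λ Λ' μ t (fun σ => c * ∑ X ∈ (latticeModel β Δ m m' Λ Λ').inner,
      ∑ Y ∈ (latticeModel β Δ m m' Λ Λ').inner, Δ X ^ 2 * Δ Y ^ 2 * ∏ k, φ X Y k (σ k))
    = c * (latticeModel β Δ m m' Λ Λ').pairSum fun g X Y =>
        ∏ k, gibbs ((latticeModel β Δ m m' Λ Λ').logw μ (t k) g) (φ X Y k) := by
  rw [quenched_eq, RotatedModel.pairSum, ← integral_const_mul]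
  refine integral_congr_ae (ae_of_all _ fun g => ?_)
  have e : (fun σ : Fin n → Config Λ => c * ∑ X ∈ (latticeModel β Δ m m' Λ Λ').inner,
      ∑ Y ∈ (latticeModel β Δ m m' Λ Λ').inner, Δ X ^ 2 * Δ Y ^ 2 * ∏ k, φ X Y k (σ k))
      = fun σ => ∑ p ∈ (latticeModel β Δ m m' Λ Λ').inner ×ˢ (latticeModel β Δ m m' Λ Λ').inner,
        c * (Δ p.1 ^ 2 * Δ p.2 ^ 2) * ∏ k, φ p.1 p.2 k (σ k) := by
    funext σ
    simp only [Finset.sum_product, Finset.mul_sum, mul_assoc]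
  beta_reduce
  rw [e, randomState_sum, Finset.sum_product, Finset.mul_sum]
  refine Finset.sum_congr rfl fun X _ => ?_
  rw [Finset.mul_sum]
  refine Finset.sum_congr rfl fun Y _ => ?_
  rw [randomState_prod, mul_assoc]
  simp only [neg_mul_interpHam]
  rfl

variable {Λ Λ'}

lemma sum_inner (hsub : Λ' ⊆ Λ) (F : Finset (Site d) → ℝ) :
    ∑ X ∈ (latticeModel β Δ m m' Λ Λ').inner, F X = ∑ X ∈ Λ'.powerset, F X := by
  refine Finset.sum_bij (fun X _ => (X : Finset (Site d))) ?_ ?_ ?_ ?_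
  · intro X hX
    exact Finset.mem_powerset.2 (Finset.mem_filter.1 hX).2
  · intro X _ Y _ h
    exact Subtype.ext h
  · intro X hX
    have hX' := Finset.mem_powerset.1 hX
    exact ⟨⟨X, Finset.mem_powerset.2 (hX'.trans hsub)⟩,
      Finset.mem_filter.2 ⟨Finset.mem_univ _, hX'⟩, rfl⟩
  · intro X _
    rfl

lemma normCov_mul_normCov (hsub : Λ' ⊆ Λ) (σ τ ρ π : Config Λ) :
    normCov Δ Λ' σ τ * normCov Δ Λ' ρ π
      = ((Λ'.card : ℝ) ^ 2)⁻¹ * ∑ X ∈ (latticeModel β Δ m m' Λ Λ').inner,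
        ∑ Y ∈ (latticeModel β Δ m m' Λ Λ').inner,
          Δ X ^ 2 * Δ Y ^ 2 * (spinProd σ X * spinProd τ X * (spinProd ρ Y * spinProd π Y)) := by
  unfold normCov
  rw [← sum_inner β Δ m m' hsub, ← sum_inner β Δ m m' hsub, div_mul_div_comm, Finset.sum_mul_sum,
    div_eq_inv_mul, sq]
  congr 1
  refine Finset.sum_congr rfl fun X _ => Finset.sum_congr rfl fun Y _ => ?_
  ring

lemma repliconPoly_eq (hsub : Λ' ⊆ Λ) (μ t s : ℝ) :
    repliconPoly β Δ m m' Λ Λ' μ t s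
      = ((Λ'.card : ℝ) ^ 2)⁻¹ * ((latticeModel β Δ m m' Λ Λ').replicon μ t s
        + ((latticeModel β Δ m m' Λ Λ').mixed μ s t
          - (latticeModel β Δ m m' Λ Λ').mixed μ t s)) := by
  set M := latticeModel β Δ m m' Λ Λ' with hM
  set sp : ↥Λ.powerset → Config Λ → ℝ := fun X σ => spinProd σ X
  have q1 : quenched β Δ m m' Λ Λ' μ ![t, s] (fun σ => normCov Δ Λ' (σ 0) (σ 1) ^ 2)
      = ((Λ'.card : ℝ) ^ 2)⁻¹ *
        M.pairSum fun g X Y => M.pairMag μ t g X Y * M.pairMag μ s g X Y := by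
    have := quenched_pairSum β Δ m m' Λ Λ' μ ![t, s] ((Λ'.card : ℝ) ^ 2)⁻¹
      fun X Y => ![fun σ => sp X σ * sp Y σ, fun σ => sp X σ * sp Y σ]
    simp only [Fin.prod_univ_two, Matrix.cons_val_zero, Matrix.cons_val_one] at this
    refine Eq.trans ?_ this
    congr 1
    funext σ
    rw [sq, normCov_mul_normCov β Δ m m' hsub]
    congr 1
    refine Finset.sum_congr rfl fun X _ => Finset.sum_congr rfl fun Y _ => ?_
    simp only [sp]; ring
  have q2 : quenched β Δ m m' Λ Λ' μ ![s, t, s]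
        (fun σ => normCov Δ Λ' (σ 0) (σ 1) * normCov Δ Λ' (σ 1) (σ 2))
      = ((Λ'.card : ℝ) ^ 2)⁻¹ * M.mixed μ t s := by
    have := quenched_pairSum β Δ m m' Λ Λ' μ ![s, t, s] ((Λ'.card : ℝ) ^ 2)⁻¹
      -- The middle replica, at time `t`, is shared by both overlaps and therefore carries both spin
      -- products; the outer two, at time `s`, carry one each.
      fun X Y => ![sp X, fun σ => sp X σ * sp Y σ, sp Y]
    simp only [Fin.prod_univ_three, Matrix.cons_val_zero, Matrix.cons_val_one,
      Matrix.cons_val] at this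
    refine Eq.trans ?_ this
    congr 1
    funext σ
    rw [normCov_mul_normCov β Δ m m' hsub]
    congr 1
    refine Finset.sum_congr rfl fun X _ => Finset.sum_congr rfl fun Y _ => ?_
    simp only [sp]; ring
  have q3 : quenched β Δ m m' Λ Λ' μ ![t, s, s, t]
        (fun σ => normCov Δ Λ' (σ 0) (σ 1) * normCov Δ Λ' (σ 2) (σ 3))
      = ((Λ'.card : ℝ) ^ 2)⁻¹ * M.pairSum fun g X Y =>
        M.mag μ t g X * M.mag μ s g X * (M.mag μ s g Y * M.mag μ t g Y) := by
    have := quenched_pairSum β Δ m m' Λ Λ' μ ![t, s, s, t] ((Λ'.card : ℝ) ^ 2)⁻¹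
      fun X Y => ![sp X, sp X, sp Y, sp Y]
    simp only [Fin.prod_univ_four, Matrix.cons_val_zero, Matrix.cons_val_one,
      Matrix.cons_val, mul_assoc] at this
    simp only [mul_assoc]
    refine Eq.trans ?_ this
    congr 1
    funext σ
    rw [normCov_mul_normCov β Δ m m' hsub]
    congr 1
    refine Finset.sum_congr rfl fun X _ => Finset.sum_congr rfl fun Y _ => ?_
    simp only [sp]; ring
  rw [← M.pairSum_sub_add_eq, repliconPoly, q1, q2, q3]
  ring

lemma totalVar_latticeModel :
    (latticeModel β Δ m m' Λ Λ').totalVar = ∑ X ∈ Λ.powerset, Δ X ^ 2 :=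
  Finset.sum_coe_sort Λ.powerset fun X => Δ X ^ 2

lemma totalMean_latticeModel (hsub : Λ' ⊆ Λ) :
    (latticeModel β Δ m m' Λ Λ').totalMean = ∑ X ∈ Λ'.powerset, |m' X| :=
  sum_inner β Δ m m' hsub fun X => |m' X|

lemma integral_repliconPoly_eq (hsub : Λ' ⊆ Λ) (μ₁ μ₂ : ℝ) :
    ∫ μ in μ₁..μ₂, ∫ t in (0 : ℝ)..Real.pi, ∫ s in (0 : ℝ)..Real.pi,
        Real.sin (t - s) ^ 2 * repliconPoly β Δ m m' Λ Λ' μ t s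
      = ((Λ'.card : ℝ) ^ 2)⁻¹ * ∫ μ in μ₁..μ₂, ∫ t in (0 : ℝ)..Real.pi,
        ∫ s in (0 : ℝ)..Real.pi,
          Real.sin (t - s) ^ 2 * (latticeModel β Δ m m' Λ Λ').replicon μ t s := by
  simp_rw [repliconPoly_eq β Δ m m' hsub, mul_left_comm _ ((Λ'.card : ℝ) ^ 2)⁻¹,
    intervalIntegral.integral_const_mul, RotatedModel.integral_sin_sq_mul_symm]

end Lattice

/-! ### The thermodynamic limit. -/

section Limit

/-- Two zeros in `(0, π]` would give `sin (t - s) = 0` with `|t - s| < π`, so there is at most one.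
At a zero the exponent is blind to `μ` and the self-averaging estimate is void. -/
lemma ae_cos_add_sin_ne_zero :
    ∀ᵐ t : ℝ, t ∈ Set.uIoc 0 Real.pi → Real.cos t + Real.sin t ≠ 0 := by
  have hs : {t : ℝ | t ∈ Set.uIoc 0 Real.pi ∧ Real.cos t + Real.sin t = 0}.Subsingleton := by
    rintro t ⟨ht, ht0⟩ s ⟨hs, hs0⟩
    rw [Set.uIoc_of_le Real.pi_pos.le] at ht hs
    have h : Real.sin (t - s) = 0 := by
      rw [Real.sin_sub, eq_neg_of_add_eq_zero_right ht0, eq_neg_of_add_eq_zero_right hs0]; ring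
    rw [Real.sin_eq_zero_iff_of_lt_of_lt (by linarith [ht.1, hs.2]) (by linarith [ht.2, hs.1])] at h
    exact sub_eq_zero.1 h
  filter_upwards [measure_eq_zero_iff_ae_notMem.1 (hs.measure_zero volume)] with t h ht h0
  exact h ⟨ht, h0⟩

lemma tendsto_card_of_tendsto_atTop {α : Type*} [Infinite α] {Λ : ℕ → Finset α}
    (h : Tendsto Λ atTop atTop) : Tendsto (fun n => ((Λ n).card : ℝ)) atTop atTop := by
  refine tendsto_natCast_atTop_atTop.comp (tendsto_atTop.2 fun k => ?_)
  obtain ⟨s, hs⟩ := Infinite.exists_subset_card_eq α k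
  filter_upwards [h.eventually_ge_atTop s] with n hn
  rw [← hs]
  exact Finset.card_le_card hn

lemma inv_sq_mul_integral_varMagIn_nonneg {S ι : Type*} [Fintype S] [Fintype ι] [DecidableEq ι]
    (M : RotatedModel S ι) (v : ℝ) {μ₁ μ₂ : ℝ} (hμ : μ₁ ≤ μ₂) (t : ℝ) :
    0 ≤ (v ^ 2)⁻¹ * ∫ μ in μ₁..μ₂, M.varMagIn μ t :=
  mul_nonneg (by positivity)
    (intervalIntegral.integral_nonneg hμ fun _ _ => variance_nonneg _ _)

variable {S ι : ℕ → Type*} [∀ n, Fintype (S n)] [∀ n, Nonempty (S n)] [∀ n, Fintype (ι n)]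
  [∀ n, DecidableEq (ι n)]

/-- In a sequence of models with extensive total mean `V` and total variance `o(V ^ 2)`, the
intensive magnetization conjugate to `μ` is self-averaging. -/
lemma tendsto_integral_varMagIn (M : ∀ n, RotatedModel (S n) (ι n)) (hβ : ∀ n, 0 < (M n).β)
    {V r : ℕ → ℝ} (hV : ∀ᶠ n in atTop, 0 < V n) (hr : Tendsto r atTop (𝓝 0))
    (hr0 : ∀ᶠ n in atTop, 0 < r n) {c₁ c₂ : ℝ}
    (hvar : ∀ᶠ n in atTop, (M n).totalVar ≤ c₁ * (V n ^ 2 * r n))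
    (hmean : ∀ᶠ n in atTop, (M n).totalMean ≤ c₂ * V n) {μ₁ μ₂ : ℝ} (hμ : μ₁ ≤ μ₂) :
    Tendsto (fun n => ∫ t in (0 : ℝ)..Real.pi, (V n ^ 2)⁻¹ * ∫ μ in μ₁..μ₂, (M n).varMagIn μ t)
      atTop (𝓝 0) := by
  -- The estimate at fixed `t` degenerates as `cos t + sin t` approaches zero, hence dominated
  -- convergence rather than a uniform bound. The dominating constant comes from the deterministic
  -- bound on the magnetization.
  have key := intervalIntegral.tendsto_integral_filter_of_dominated_convergence
    (μ := volume) (a := 0) (b := Real.pi) (l := atTop)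
    (F := fun n t => (V n ^ 2)⁻¹ * ∫ μ in μ₁..μ₂, (M n).varMagIn μ t) (f := fun _ => 0)
    (fun _ => c₂ ^ 2 * (μ₂ - μ₁)) ?_ ?_ (by simp) ?_
  · simpa using key
  · refine Eventually.of_forall fun n => Continuous.aestronglyMeasurable ?_
    exact (continuous_intervalIntegral (f := fun μ t => (M n).varMagIn μ t)
      (M n).continuous_varMagIn _ _).const_mul _
  · filter_upwards [hV, hmean] with n hn hm
    refine ae_of_all _ fun t _ => ?_
    rw [Real.norm_of_nonneg (inv_sq_mul_integral_varMagIn_nonneg (M n) (V n) hμ t),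
      inv_mul_le_iff₀ (by positivity)]
    have h := abs_intervalIntegral_le (f := fun μ => (M n).varMagIn μ t)
      (C := (M n).totalMean ^ 2) (fun μ => by
        exact (abs_of_nonneg (variance_nonneg _ _)).trans_le ((M n).varMagIn_le μ t)) hμ
    refine (le_abs_self _).trans (h.trans ?_)
    have h2 : (M n).totalMean ^ 2 ≤ (c₂ * V n) ^ 2 :=
      pow_le_pow_left₀ (M n).totalMean_nonneg hm 2
    calc (M n).totalMean ^ 2 * (μ₂ - μ₁) ≤ (c₂ * V n) ^ 2 * (μ₂ - μ₁) :=
          mul_le_mul_of_nonneg_right h2 (sub_nonneg.2 hμ)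
      _ = _ := by ring
  · filter_upwards [ae_cos_add_sin_ne_zero] with t ht htI
    set k := (Real.cos t + Real.sin t) ^ 2 with hk
    have hk0 : 0 < k := by have := ht htI; positivity
    have hlim : Tendsto (fun n => k⁻¹ * (16 * c₁ * (μ₂ - μ₁) * √(r n) + 32 * c₂ ^ 2 * √√(r n)))
        atTop (𝓝 0) := by
      have h1 : Tendsto (fun n => √(r n)) atTop (𝓝 0) := by
        simpa using hr.sqrt
      have h2 : Tendsto (fun n => √√(r n)) atTop (𝓝 0) := by
        simpa using h1.sqrt
      simpa using ((h1.const_mul (16 * c₁ * (μ₂ - μ₁))).add (h2.const_mul (32 * c₂ ^ 2))).const_mul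
        k⁻¹
    refine tendsto_of_tendsto_of_tendsto_of_le_of_le' tendsto_const_nhds hlim
      (Eventually.of_forall fun n => inv_sq_mul_integral_varMagIn_nonneg (M n) (V n) hμ t) ?_
    filter_upwards [hV, hr0, hvar, hmean] with n hn hrn hv hm
    -- The choice `δ = r^{1/4}` makes both errors vanish: after division by `V²`, the term with
    -- `δ⁻²` is of order `r / √r = √r` and the term with `δ` of order `r^{1/4}`.
    have hsq : 0 < √(r n) := Real.sqrt_pos.2 hrn
    have h := (M n).integral_varMagIn_le hμ (hβ n) t (Real.sqrt_pos.2 hsq)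
    rw [Real.sq_sqrt hsq.le, ← hk] at h
    have hm2 : (M n).totalMean ^ 2 ≤ (c₂ * V n) ^ 2 :=
      pow_le_pow_left₀ (M n).totalMean_nonneg hm 2
    rw [le_inv_mul_iff₀ hk0, mul_left_comm, inv_mul_le_iff₀ (by positivity)]
    have hd : r n / √(r n) = √(r n) := Real.div_sqrt
    calc k * ∫ μ in μ₁..μ₂, (M n).varMagIn μ t
        ≤ 16 * (M n).totalVar * (μ₂ - μ₁) / √(r n) + 32 * (M n).totalMean ^ 2 * √√(r n) := h
      _ ≤ 16 * (c₁ * (V n ^ 2 * r n)) * (μ₂ - μ₁) / √(r n) + 32 * (c₂ * V n) ^ 2 * √√(r n) := by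
          have := sub_nonneg.2 hμ
          gcongr
      _ = V n ^ 2 * (16 * c₁ * (μ₂ - μ₁) * (r n / √(r n)) + 32 * c₂ ^ 2 * √√(r n)) := by ring
      _ = _ := by rw [hd]

end Limit

end SpinFlip

end

/-! ### Proof of the theorem. -/

theorem theorem2 (d : ℕ) (hd : 1 ≤ d) (β : ℝ) (hβ : 0 < β)
    (Δ m m' : Finset (SpinFlip.Site d) → ℝ)
    (hm : SpinFlip.ThermStable m Δ) (hm' : SpinFlip.ThermStable m' Δ)
    (Λ Λ' : ℕ → Finset (SpinFlip.Site d)) (hsub : ∀ n, Λ' n ⊆ Λ n)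
    (hΛ : Tendsto Λ atTop atTop) (hΛ' : Tendsto Λ' atTop atTop)
    (a : ℝ) (ha : 0 < a)
    (hratio : Tendsto (fun n => ((Λ' n).card : ℝ) / ((Λ n).card : ℝ)) atTop (𝓝 a))
    (μ₁ μ₂ : ℝ) (hμ : μ₁ ≤ μ₂) :
    Tendsto
      (fun n => ∫ μ in μ₁..μ₂, ∫ t in (0 : ℝ)..Real.pi, ∫ s in (0 : ℝ)..Real.pi,
        Real.sin (t - s) ^ 2 * SpinFlip.repliconPoly β Δ m m' (Λ n) (Λ' n) μ t s)
      atTop (𝓝 0) := by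
  -- A positive dimension makes the lattice infinite, so that the volumes of the exhausting sets
  -- diverge.
  have : Nonempty (Fin d) := ⟨⟨0, hd⟩⟩
  obtain ⟨c₁, hc₁⟩ := hm
  obtain ⟨c₂, hc₂⟩ := hm'
  set V : ℕ → ℝ := fun n => ((Λ' n).card : ℝ) with hVdef
  set r : ℕ → ℝ := fun n => ((Λ n).card : ℝ) / V n ^ 2 with hrdef
  set M : ∀ n, SpinFlip.RotatedModel (SpinFlip.Config (Λ n)) ↥(Λ n).powerset :=
    fun n => SpinFlip.latticeModel β Δ m m' (Λ n) (Λ' n) with hM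
  have hVtop : Tendsto V atTop atTop := SpinFlip.tendsto_card_of_tendsto_atTop hΛ'
  have hV : ∀ᶠ n in atTop, 0 < V n := hVtop.eventually_gt_atTop 0
  have hN : ∀ᶠ n in atTop, 0 < ((Λ n).card : ℝ) :=
    (SpinFlip.tendsto_card_of_tendsto_atTop hΛ).eventually_gt_atTop 0
  -- `|Λ| / |Λ'|²` is the product of `|Λ| / |Λ'|`, which tends to `a⁻¹`, and `|Λ'|⁻¹`, which tends
  -- to zero. Positivity of `a` enters here.
  have hr : Tendsto r atTop (𝓝 0) := by
    have h := (hratio.inv₀ ha.ne').mul hVtop.inv_tendsto_atTop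
    rw [mul_zero] at h
    refine h.congr fun n => ?_
    simp only [hrdef, hVdef, Pi.inv_apply, inv_div]
    rw [← div_eq_mul_inv, div_div, sq]
  have hr0 : ∀ᶠ n in atTop, 0 < r n := by
    filter_upwards [hV, hN] with n h1 h2
    positivity
  have hvar : ∀ᶠ n in atTop, (M n).totalVar ≤ c₁ * (V n ^ 2 * r n) := by
    filter_upwards [hV, hN] with n h1 h2
    have h := (hc₁ (Λ n) (Finset.card_pos.1 (Nat.cast_pos.1 h2))).2
    rw [div_le_iff₀ h2] at h
    rw [hM, SpinFlip.totalVar_latticeModel, hrdef, mul_div_cancel₀ _ (by positivity)]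
    exact h
  have hmean : ∀ᶠ n in atTop, (M n).totalMean ≤ c₂ * V n := by
    filter_upwards [hV] with n h1
    have h := (hc₂ (Λ' n) (Finset.card_pos.1 (Nat.cast_pos.1 h1))).1
    rw [div_le_iff₀ h1] at h
    rw [hM, SpinFlip.totalMean_latticeModel β Δ m m' (hsub n)]
    exact h
  have hself := SpinFlip.tendsto_integral_varMagIn M (fun _ => hβ) hV hr hr0 hvar hmean hμ
  have hβ2 : 0 < β ^ 2 := by positivity
  have hlim := ((hr.const_mul ((Real.pi ^ 2 + 16) * (μ₂ - μ₁) * c₁)).add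
    (hself.const_mul (8 * Real.pi * (μ₁ ^ 2 + μ₂ ^ 2)))).const_mul (β ^ 2)⁻¹
  rw [mul_zero, mul_zero, add_zero, mul_zero] at hlim
  refine squeeze_zero_norm' ?_ hlim
  filter_upwards [hV, hvar] with n h1 h2
  rw [SpinFlip.integral_repliconPoly_eq β Δ m m' (hsub n), norm_mul, Real.norm_eq_abs,
    Real.norm_eq_abs, abs_of_nonneg (by positivity), le_inv_mul_iff₀ hβ2, mul_left_comm,
    inv_mul_le_iff₀ (by positivity)]
  have h := (M n).sq_mul_abs_integral_integral_replicon_le hβ hμ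
  refine h.trans ?_
  rw [intervalIntegral.integral_const_mul]
  have h3 : (Real.pi ^ 2 + 16) * (μ₂ - μ₁) * (M n).totalVar
      ≤ (Real.pi ^ 2 + 16) * (μ₂ - μ₁) * (c₁ * (V n ^ 2 * r n)) := by
    have := sub_nonneg.2 hμ
    gcongr
  -- Multiplying the fluctuation term by `V² · (V²)⁻¹ = 1` gives it the normalization used in
  -- `hself`.
  have h4 : V n ^ 2 * (V n ^ 2)⁻¹ = 1 := mul_inv_cancel₀ (by positivity)
  calc _ ≤ (Real.pi ^ 2 + 16) * (μ₂ - μ₁) * (c₁ * (V n ^ 2 * r n))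
        + 8 * Real.pi * (μ₁ ^ 2 + μ₂ ^ 2) * (1 *
          ∫ t in (0 : ℝ)..Real.pi, ∫ μ in μ₁..μ₂, (M n).varMagIn μ t) := by
        rw [one_mul]; gcongr
    _ = _ := by rw [← h4]; ring
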